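/- Let $\Bbbk$ be an algebraically closed field of characteristic $0$. Let $\mathbb{T}_3$ be the rack of transpositions of the symmetric group $\mathbb{S}_3$ (with $x\triangleright y=xyx^{-1}$) and let $G=G_{\mathbb{T}_3}$ be its enveloping group, generated by $g_x$, $x\in\mathbb{T}_3$, with relations $g_xg_y=g_{x\triangleright y}g_x$. Let $t\in\Bbbk^{\times}$, let $\rho_t$ be the one-dimensional representation of the centralizer $G^{g_{(1\,2)}}=\langle g_{(1\,2)}\rangle$ on which $g_{(1\,2)}$ acts by multiplication with $t$, and let $V=M(g_{(1\,2)},\rho_t)=\Bbbk G\otimes_{\Bbbk G^{g_{(1\,2)}}}\Bbbk$ be the Yetter-Drinfeld module over $\Bbbk G$ with action on the left tensor factor and with $\deg(h\otimes v)=hg_{(1\,2)}h^{-1}$. Let $\mathcal{B}(V)=\bigoplus_{n\ge 0}V^{\otimes n}/\ker S_n$ be its Nichols algebra, where $S_n$ is the braided symmetrizer of $V^{\otimes n}$ for the Yetter-Drinfeld braiding of $V$. A left coideal subalgebra of $\mathcal{B}(V)$ in the category of $\mathbb{N}_0$-graded $\Bbbk G$-comodules is a subalgebra $C$ (with $1$)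 that is an $\mathbb{N}_0$-graded left $\Bbbk G$-subcomodule and satisfies $\Delta(C)\subseteq\mathcal{B}(V)\otimes C$; it is generated in degree one if $C$ is generated as an algebra by $C(1)=C\cap V$. 1. If $t=-1$ or $t^2-t+1=0$, then all left coideal subalgebras of $\mathcal{B}(V)$ in the category of $\mathbb{N}_0$-graded $\Bbbk G$-comodules are generated in degree one. 2. If $t\ne-1$ and $t^2-t+1\neq 0$, then for every $v_a\in V_{g_{(1\,2)}}\setminus\{0\}$, with $v_b=t^{-1}g_{(2\,3)}\cdot v_a$ and $v_c=t^{-1}g_{(1\,3)}\cdot v_a$, the subalgebra $\langle v_b,\;v_av_b-t\,v_cv_a+t^2\,v_bv_c\rangle$ is a left coideal subalgebra of $\mathcal{B}(V)$ in the category of $\mathbb{N}_0$-graded $\Bbbk G$-comodules that is not generated in degree one. -/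

import Mathlib

open scoped TensorProduct

noncomputable section

/-! ### Yetter-Drinfeld modules over group algebras -/

/-- A Yetter-Drinfeld structure over the group algebra `k[G]` on the vector space `V`: a linear
action of `G` and a left `k[G]`-coaction, i.e. a `G`-grading.  The coaction `V → k[G] ⊗ V` is
written as `v ↦ (v_g)_g`, where `v_g = coaction v g` is the component of degree `g` of `v`
(so `δ(v) = ∑_g g ⊗ v_g`), and the compatibility condition says `g · V_h ⊆ V_{g h g⁻¹}`. -/
structure YetterDrinfeld (k G V : Type*) [Field k] [Group G] [AddCommGroup V] [Module k V] where
  action : Representation k G V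
  coaction : V →ₗ[k] (G →₀ V)
  coassoc : ∀ v g, coaction (coaction v g) = Finsupp.single g (coaction v g)
  counit : ∀ v, (coaction v).sum (fun _ w => w) = v
  compat : ∀ g v h, coaction (action g v) (g * h * g⁻¹) = action g (coaction v h)

namespace YetterDrinfeld

section Generalities

variable {k G V : Type*} [Field k] [Group G] [AddCommGroup V] [Module k V]
variable (D : YetterDrinfeld k G V)

/-- The homogeneous component `V_g = {v | δ(v) = g ⊗ v}`. -/
def component (g : G) : Submodule k V :=
  LinearMap.eqLocus D.coaction (Finsupp.lsingle g)

variable {W : Type*} [AddCommGroup W] [Module k W]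

/-- The braiding `c_{V,W} : V ⊗ W → W ⊗ V`, `c(v ⊗ w) = ∑_g (g · w) ⊗ v_g`. -/
def braiding (σ : Representation k G W) : V ⊗[k] W →ₗ[k] W ⊗[k] V :=
  TensorProduct.lift
    ((Finsupp.lsum k fun g : G =>
      (LinearMap.lcomp k (W ⊗[k] V) (σ g)) ∘ₗ (TensorProduct.mk k W V).flip) ∘ₗ D.coaction)

theorem braiding_tmul (σ : Representation k G W) (v : V) (w : W) :
    D.braiding σ (v ⊗ₜ w) = (D.coaction v).sum fun g u => σ g w ⊗ₜ[k] u := by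
  simp [braiding, Finsupp.sum]

/-- The map `V ⊗ (W ⊗ T(V)) → W ⊗ T(V)` which applies the braiding `c_{V,W}` to the first two
tensor factors and then multiplies in `T(V)`:
`v ⊗ (w ⊗ x) ↦ ∑_g (g · w) ⊗ (v_g x)`. -/
def braidPast (σ : Representation k G W) :
    V ⊗[k] (W ⊗[k] TensorAlgebra k V) →ₗ[k] W ⊗[k] TensorAlgebra k V :=
  (LinearMap.mul' k (TensorAlgebra k V) ∘ₗ
      (TensorAlgebra.ι k).rTensor (TensorAlgebra k V)).lTensor W ∘ₗ
    (TensorProduct.assoc k W V (TensorAlgebra k V)).toLinearMap ∘ₗ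
    (D.braiding σ).rTensor (TensorAlgebra k V) ∘ₗ
    (TensorProduct.assoc k V W (TensorAlgebra k V)).symm.toLinearMap

theorem braidPast_tmul (σ : Representation k G W) (v : V) (w : W) (x : TensorAlgebra k V) :
    D.braidPast σ (v ⊗ₜ (w ⊗ₜ x)) =
      (D.coaction v).sum fun g u => σ g w ⊗ₜ[k] (TensorAlgebra.ι k u * x) := by
  simp [braidPast, braiding_tmul, Finsupp.sum, TensorProduct.sum_tmul]

/-- The linear map `F` on `T(V)` with `F 1 = n` and `F (v x) = f v (F x)` for `v ∈ V`. -/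
def fold {N : Type*} [AddCommGroup N] [Module k N] (f : V →ₗ[k] Module.End k N) (n : N) :
    TensorAlgebra k V →ₗ[k] N :=
  LinearMap.applyₗ n ∘ₗ (TensorAlgebra.lift k f).toLinearMap

theorem fold_one {N : Type*} [AddCommGroup N] [Module k N] (f : V →ₗ[k] Module.End k N) (n : N) :
    fold f n 1 = n := by
  simp [fold]

theorem fold_ι_mul {N : Type*} [AddCommGroup N] [Module k N] (f : V →ₗ[k] Module.End k N) (n : N)
    (v : V) (x : TensorAlgebra k V) :
    fold f n (TensorAlgebra.ι k v * x) = f v (fold f n x) := by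
  simp [fold]

/-! ### The braided symmetrizer -/

/-- One step of the recursion for `shuffle`: `(x, y) ↦ (v x, v ⊗ x + c₁ (v ⊗ y))`. -/
def shuffleStep : V →ₗ[k] Module.End k (TensorAlgebra k V × (V ⊗[k] TensorAlgebra k V)) :=
  LinearMap.mk₂ k
    (fun v p => (TensorAlgebra.ι k v * p.1, v ⊗ₜ[k] p.1 + D.braidPast D.action (v ⊗ₜ[k] p.2)))
    (fun v v' p => by
      simp only [map_add, add_mul, TensorProduct.add_tmul, Prod.mk_add_mk]; congr 1; abel)
    (fun a v p => by
      simp only [map_smul, smul_mul_assoc, ← TensorProduct.smul_tmul', Prod.smul_mk, smul_add])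
    (fun v p p' => by
      simp only [Prod.fst_add, Prod.snd_add, mul_add, TensorProduct.tmul_add, map_add,
        Prod.mk_add_mk]; congr 1; abel)
    (fun a v p => by
      simp)

/-- The map `T(V) → V ⊗ T(V)` which on `V^{⊗ n} = V ⊗ V^{⊗ (n-1)}` is
`1 + c₁ + c₁c₂ + ⋯ + c₁c₂⋯c_{n-1}`. -/
def shuffle : TensorAlgebra k V →ₗ[k] V ⊗[k] TensorAlgebra k V :=
  LinearMap.snd k _ _ ∘ₗ fold D.shuffleStep (1, 0)

theorem shuffle_one : D.shuffle 1 = 0 := by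
  simp [shuffle, fold_one]

theorem fst_fold_shuffleStep (x : TensorAlgebra k V) :
    (fold D.shuffleStep (1, 0) x).1 = x := by
  suffices h : ∀ x y : TensorAlgebra k V,
      ((TensorAlgebra.lift k D.shuffleStep x) (y, 0)).1 = x * y ∧
      ∀ z, ((TensorAlgebra.lift k D.shuffleStep x) (y, z)).1 = x * y by
    simpa [fold] using (h x 1).1
  intro x y
  suffices h : ∀ (y : TensorAlgebra k V) z,
      ((TensorAlgebra.lift k D.shuffleStep x) (y, z)).1 = x * y from ⟨h y 0, h y⟩
  induction x using TensorAlgebra.induction with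
  | algebraMap r => intro y z; simp [Algebra.smul_def]
  | ι v => intro y z; simp [shuffleStep]
  | mul a b ha hb =>
    intro y z
    have := hb y z
    rw [map_mul, Module.End.mul_apply]
    rw [← Prod.mk.eta (p := (TensorAlgebra.lift k D.shuffleStep b) (y, z)), ha, hb, mul_assoc]
  | add a b ha hb => intro y z; simp [ha, hb, add_mul]

/-- On `v x` with `v ∈ V`, the map `1 + c₁ + c₁c₂ + ⋯` is `1 + c₁ (1 + c₂ + c₂c₃ + ⋯)`. -/
theorem shuffle_ι_mul (v : V) (x : TensorAlgebra k V) :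
    D.shuffle (TensorAlgebra.ι k v * x) =
      v ⊗ₜ x + D.braidPast D.action (v ⊗ₜ D.shuffle x) := by
  have h := D.fst_fold_shuffleStep x
  simp only [shuffle, LinearMap.comp_apply, fold_ι_mul]
  generalize fold D.shuffleStep (1, 0) x = p at h ⊢
  subst h
  simp [shuffleStep]

/-- `D.symmetrizer n` restricts on `V^{⊗ n} ⊆ T(V)` to the braided symmetrizer
`S_n = ∑_{s ∈ 𝕊_n} τ(ν(s))`, where `τ(ν(s)) = c_{i₁} ⋯ c_{i_m}` for a reduced expression
`s = s_{i₁} ⋯ s_{i_m}`.  Each `s ∈ 𝕊_{n+1}` is uniquely `s' · (s₁ s₂ ⋯ s_j)` with `0 ≤ j ≤ n` and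
`s'` in the subgroup generated by `s₂, …, s_n`, and the lengths of the two factors add up; hence
`S_{n+1} = (id ⊗ S_n) (1 + c₁ + c₁c₂ + ⋯ + c₁⋯c_n)`. -/
def symmetrizer : ℕ → (TensorAlgebra k V →ₗ[k] TensorAlgebra k V)
  | 0 => LinearMap.id
  | n + 1 => LinearMap.mul' k (TensorAlgebra k V) ∘ₗ
      TensorProduct.map (TensorAlgebra.ι k) (symmetrizer n) ∘ₗ D.shuffle

/-! ### The Nichols algebra -/

/-- The ideal of `T(V)` generated by the kernels of `S_n` on `V^{⊗ n}` for all `n`. -/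
def nicholsIdeal : TwoSidedIdeal (TensorAlgebra k V) :=
  TwoSidedIdeal.span
    {x | ∃ n : ℕ, x ∈ LinearMap.range (TensorAlgebra.ι k : V →ₗ[k] TensorAlgebra k V) ^ n ∧
      D.symmetrizer n x = 0}

/-- The Nichols algebra `B(V) = ⨁_n V^{⊗ n} / ker S_n`, as a quotient algebra of `T(V)`. -/
abbrev Nichols : Type _ := TensorAlgebra k V ⧸ D.nicholsIdeal.asIdeal

/-- The quotient map `T(V) → B(V)`. -/
def toNichols : TensorAlgebra k V →ₐ[k] D.Nichols :=
  Ideal.Quotient.mkₐ k D.nicholsIdeal.asIdeal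

/-- The inclusion `V → B(V)`. -/
def ι : V →ₗ[k] D.Nichols := D.toNichols.toLinearMap ∘ₗ TensorAlgebra.ι k

/-- The component `B(V)(n)` of degree `n` of the `ℕ`-grading. -/
def nicholsDegree (n : ℕ) : Submodule k D.Nichols := LinearMap.range D.ι ^ n

/-- The component of degree `g` of the `G`-grading of `B(V)` (i.e. of the diagonal
`k[G]`-coaction), spanned by the products `v₁ ⋯ v_m` with `v_i ∈ V_{g_i}` and `g₁ ⋯ g_m = g`. -/
def nicholsComponent (g : G) : Submodule k D.Nichols :=
  Submodule.span k {x | ∃ l : List (G × V), (∀ p ∈ l, p.2 ∈ D.component p.1) ∧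
    (l.map Prod.fst).prod = g ∧ x = (l.map fun p => D.ι p.2).prod}

/-- The action of `G` on `T(V)` by algebra automorphisms (the diagonal action on `V^{⊗ n}`). -/
def tensorAction : Representation k G (TensorAlgebra k V) where
  toFun g := (TensorAlgebra.lift k (TensorAlgebra.ι k ∘ₗ D.action g)).toLinearMap
  map_one' := by
    have h : TensorAlgebra.lift k (TensorAlgebra.ι k ∘ₗ D.action 1) =
        AlgHom.id k (TensorAlgebra k V) := by
      ext v; simp
    rw [h]; rfl
  map_mul' g h := by
    have h : TensorAlgebra.lift k (TensorAlgebra.ι k ∘ₗ D.action (g * h)) =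
        (TensorAlgebra.lift k (TensorAlgebra.ι k ∘ₗ D.action g)).comp
          (TensorAlgebra.lift k (TensorAlgebra.ι k ∘ₗ D.action h)) := by
      ext v; simp
    rw [h]; rfl

/-- The step of the recursion for `comul`: multiplication by `v ⊗ 1 + 1 ⊗ v` from the left
in the braided tensor product algebra `T(V) ⊗ T(V)`, that is
`x ⊗ y ↦ v x ⊗ y + ∑_g (g · x) ⊗ v_g y`. -/
def comulStep : V →ₗ[k] Module.End k (TensorAlgebra k V ⊗[k] TensorAlgebra k V) :=
  LinearMap.rTensorHom (TensorAlgebra k V) ∘ₗ LinearMap.mul k (TensorAlgebra k V) ∘ₗ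
      TensorAlgebra.ι k +
    TensorProduct.curry (D.braidPast D.tensorAction)

theorem comulStep_tmul (v : V) (x y : TensorAlgebra k V) :
    D.comulStep v (x ⊗ₜ y) = (TensorAlgebra.ι k v * x) ⊗ₜ y +
      (D.coaction v).sum fun g u => D.tensorAction g x ⊗ₜ[k] (TensorAlgebra.ι k u * y) := by
  simp [comulStep, braidPast_tmul]

/-- The comultiplication `Δ : T(V) → T(V) ⊗ T(V)` of the braided Hopf algebra `T(V)`: the algebra
map to the braided tensor product algebra with `Δ(v) = v ⊗ 1 + 1 ⊗ v` for `v ∈ V`, given by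
`Δ(1) = 1 ⊗ 1` and `Δ(v x) = (v ⊗ 1 + 1 ⊗ v) Δ(x)`. -/
def comul : TensorAlgebra k V →ₗ[k] TensorAlgebra k V ⊗[k] TensorAlgebra k V :=
  fold D.comulStep (1 ⊗ₜ 1)

/-- `C` is a left coideal of `B(V)`: `Δ(C) ⊆ B(V) ⊗ C`, where the comultiplication of `B(V)` is
induced by the one of `T(V)`, i.e. `Δ_{B(V)}(π(x)) = (π ⊗ π)(Δ(x))` for `π : T(V) → B(V)`. -/
def IsLeftCoideal (C : Submodule k D.Nichols) : Prop :=
  ∀ x : TensorAlgebra k V, D.toNichols x ∈ C →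
    TensorProduct.map D.toNichols.toLinearMap D.toNichols.toLinearMap (D.comul x) ∈
      LinearMap.range (C.subtype.lTensor D.Nichols)

/-- `C` is a left coideal subalgebra of `B(V)` in the category of `ℕ`-graded `k[G]`-comodules:
a subalgebra and left coideal which is the sum of its homogeneous parts for the `ℕ`-grading
and for the `G`-grading (the `k[G]`-coaction). -/
structure IsLeftCoidealSubalgebra (C : Subalgebra k D.Nichols) : Prop where
  leftCoideal : D.IsLeftCoideal (Subalgebra.toSubmodule C)
  graded : Subalgebra.toSubmodule C ≤ ⨆ n, Subalgebra.toSubmodule C ⊓ D.nicholsDegree n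
  subcomodule : Subalgebra.toSubmodule C ≤ ⨆ g, Subalgebra.toSubmodule C ⊓ D.nicholsComponent g

/-- `C` is generated, as an algebra, by its part `C(1)` of degree one. -/
def GeneratedInDegreeOne (C : Subalgebra k D.Nichols) : Prop :=
  C = Algebra.adjoin k ((Subalgebra.toSubmodule C ⊓ D.nicholsDegree 1 : Submodule k D.Nichols) :
    Set D.Nichols)

end Generalities

/-! ### The Yetter-Drinfeld modules `M(g, ρ)` -/

section Induced

variable {k G A : Type*} [Field k] [Group G] [AddCommGroup A] [Module k A]
variable (g : G) (ρ : Representation k (Subgroup.centralizer {g}) A)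

/-- The vector space `M(g, ρ) = k[G] ⊗_{k[G^g]} A` for a representation `ρ` on `A` of the
centralizer `G^g`, realised as the induced representation.  In the conventions used there,
`IndV.mk _ _ h a` is the element `h⁻¹ ⊗ a` of `k[G] ⊗_{k[G^g]} A`. -/
abbrev Ind : Type _ := Representation.IndV (Subgroup.centralizer {g}).subtype ρ

/-- The element `h ⊗ a` of `M(g, ρ)`. -/
abbrev Ind.mk (h : G) : A →ₗ[k] Ind g ρ :=
  Representation.IndV.mk (Subgroup.centralizer {g}).subtype ρ h⁻¹

/-- The coaction of `M(g, ρ)`: the element `h ⊗ a` is homogeneous of degree `h g h⁻¹`. -/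
def Ind.coaction : Ind g ρ →ₗ[k] (G →₀ Ind g ρ) :=
  Representation.Coinvariants.lift _
    (TensorProduct.lift
      (Finsupp.lsum k (fun h : G => LinearMap.toSpanSingleton k (A →ₗ[k] (G →₀ Ind g ρ))
        (Finsupp.lsingle (h⁻¹ * g * h) ∘ₗ Ind.mk g ρ h⁻¹)) ∘ₗ
        (MonoidAlgebra.coeffLinearEquiv k).toLinearMap))
    (fun z => by
      ext h a : 4
      have hz : (z : G)⁻¹ * g * z = g := by
        have := Subgroup.mem_centralizer_singleton_iff.1 z.2
        rw [mul_assoc, ← this, inv_mul_cancel_left]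
      have h1 : ((z : G) * h)⁻¹ * g * (z * h) = h⁻¹ * g * h := by
        rw [mul_inv_rev]
        calc h⁻¹ * (z : G)⁻¹ * g * (z * h) = h⁻¹ * ((z : G)⁻¹ * g * z) * h := by group
          _ = _ := by rw [hz]
      have h2 : Ind.mk g ρ (z * h)⁻¹ (ρ z a) = Ind.mk g ρ h⁻¹ a := by
        simpa [Ind.mk] using Representation.Coinvariants.mk_self_apply
          (Representation.tprod ((Representation.leftRegular k G).comp
            (Subgroup.centralizer {g}).subtype) ρ) z (MonoidAlgebra.single h 1 ⊗ₜ a)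
      have h3 : Finsupp.single (((z : G) * h)⁻¹ * g * (z * h)) (Ind.mk g ρ (z * h)⁻¹ (ρ z a)) =
          Finsupp.single (h⁻¹ * g * h) (Ind.mk g ρ h⁻¹ a) := by rw [h1, h2]
      simpa using h3)

theorem Ind.induction {P : Ind g ρ → Prop} (x : Ind g ρ) (mk : ∀ h a, P (Ind.mk g ρ h a))
    (zero : P 0) (add : ∀ x y, P x → P y → P (x + y)) : P x := by
  induction x using Representation.Coinvariants.induction_on with
  | h v =>
    induction v using TensorProduct.induction_on with
    | zero => simpa using zero
    | add x y hx hy => simpa using add _ _ hx hy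
    | tmul f a =>
      induction f using MonoidAlgebra.induction_linear with
      | zero => simpa using zero
      | add x y hx hy => simpa [TensorProduct.add_tmul] using add _ _ hx hy
      | single h r =>
        have := mk h⁻¹ (r • a)
        rwa [Ind.mk, inv_inv, LinearMap.comp_apply, TensorProduct.mk_apply,
          ← TensorProduct.smul_tmul, MonoidAlgebra.smul_single, smul_eq_mul, mul_one] at this

theorem Ind.coaction_mk (h : G) (a : A) :
    Ind.coaction g ρ (Ind.mk g ρ h a) = Finsupp.single (h * g * h⁻¹) (Ind.mk g ρ h a) := by
  simp [Ind.coaction]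

/-- The Yetter-Drinfeld module `M(g, ρ)`: the action is `h' · (h ⊗ a) = h' h ⊗ a`, and
`h ⊗ a` has degree `h g h⁻¹`. -/
def ind : YetterDrinfeld k G (Ind g ρ) where
  action := Representation.ind (Subgroup.centralizer {g}).subtype ρ
  coaction := Ind.coaction g ρ
  coassoc v x := by
    induction v using Ind.induction with
    | mk h a =>
      rw [Ind.coaction_mk]
      by_cases hx : h * g * h⁻¹ = x
      · subst hx; rw [Finsupp.single_eq_same, Ind.coaction_mk]
      · simp [Finsupp.single_eq_of_ne' hx]
    | zero => simp
    | add v w hv hw => simp [hv, hw]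
  counit v := by
    induction v using Ind.induction with
    | mk h a => rw [Ind.coaction_mk]; simp
    | zero => simp
    | add v w hv hw =>
      rw [map_add, Finsupp.sum_add_index' (fun _ => rfl) (fun _ _ _ => rfl), hv, hw]
  compat x v y := by
    induction v using Ind.induction with
    | mk h a =>
      have hx : Representation.ind (Subgroup.centralizer {g}).subtype ρ x (Ind.mk g ρ h a) =
          Ind.mk g ρ (x * h) a := by
        simp [Ind.mk]
      rw [hx, Ind.coaction_mk, Ind.coaction_mk]
      have he : x * h * g * (x * h)⁻¹ = x * (h * g * h⁻¹) * x⁻¹ := by group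
      rw [he]
      by_cases hy : h * g * h⁻¹ = y
      · subst hy; rw [Finsupp.single_eq_same, Finsupp.single_eq_same, hx]
      · rw [Finsupp.single_eq_of_ne' hy, map_zero, Finsupp.single_eq_of_ne']
        intro h'
        exact hy (mul_left_cancel (mul_right_cancel h'))
    | zero => simp
    | add v w hv hw => simp only [map_add, Finsupp.add_apply, hv, hw]

theorem ind_action_mk (h' h : G) (a : A) :
    (ind g ρ).action h' (Ind.mk g ρ h a) = Ind.mk g ρ (h' * h) a := by
  simp [ind, Ind.mk]

end Induced

end YetterDrinfeld

/-! ### The rack of transpositions -/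

/-- The transpositions of the symmetric group `𝕊_n`, acting on `Fin n`. -/
def TranspositionRack (n : ℕ) : Type := {σ : Equiv.Perm (Fin n) // σ.IsSwap}

namespace TranspositionRack

theorem isSwap_conj {n : ℕ} (σ τ : Equiv.Perm (Fin n)) (h : τ.IsSwap) : (σ * τ * σ⁻¹).IsSwap := by
  obtain ⟨x, y, hxy, rfl⟩ := h
  exact ⟨σ x, σ y, fun h => hxy (σ.injective h), (Equiv.swap_apply_apply σ x y).symm⟩

/-- The rack `𝕋_n` of transpositions, with `σ ◃ τ = σ τ σ⁻¹`. -/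
instance (n : ℕ) : Rack (TranspositionRack n) where
  act σ τ := ⟨σ.1 * τ.1 * σ.1⁻¹, isSwap_conj _ _ τ.2⟩
  self_distrib := Subtype.ext (by simp [mul_assoc])
  invAct σ τ := ⟨σ.1⁻¹ * τ.1 * σ.1, by simpa using isSwap_conj σ.1⁻¹ τ.1 τ.2⟩
  left_inv σ τ := Subtype.ext (by simp [mul_assoc])
  right_inv σ τ := Subtype.ext (by simp [mul_assoc])

/-- The transposition `(i j)`. -/
def swap {n : ℕ} (i j : Fin n) (h : i ≠ j) : TranspositionRack n :=
  ⟨Equiv.swap i j, i, j, h, rfl⟩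

/-- The enveloping group `G_{𝕋_n}` of the rack `𝕋_n`. -/
abbrev Env (n : ℕ) : Type := Rack.EnvelGroup (TranspositionRack n)

/-- The generator `g_{(i j)}` of the enveloping group `G_{𝕋_n}`. -/
def gen {n : ℕ} (i j : Fin n) (h : i ≠ j) : Env n :=
  Rack.toEnvelGroup (TranspositionRack n) (swap i j h)

/-- The element `g_{(1 2)}` of `G_{𝕋_3}`; the points `1, 2, 3` are written `0, 1, 2 : Fin 3`. -/
def g12 : Env 3 := gen 0 1 (by decide)

/-- The element `g_{(1 3)}` of `G_{𝕋_3}`. -/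
def g13 : Env 3 := gen 0 2 (by decide)

/-- The element `g_{(2 3)}` of `G_{𝕋_3}`. -/
def g23 : Env 3 := gen 1 2 (by decide)

section

variable {k : Type*} [Field k]

/-- The character of `G_{𝕋_n}` with value `t` on all generators. -/
def charConst (n : ℕ) (t : kˣ) : Env n →* kˣ :=
  Rack.toEnvelGroup.map
    { toFun := fun _ => t
      map_act' := by intro x y; simp }

theorem charConst_gen {n : ℕ} (t : kˣ) (i j : Fin n) (h : i ≠ j) : charConst n t (gen i j h) = t := rfl

/-- The one-dimensional representation `ρ_t`, on the vector space `k`, of the centralizer of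
`g_{(1 2)}` in `G_{𝕋_3}` for which `g_{(1 2)}` acts as multiplication by `t`.  (This centralizer is
generated by `g_{(1 2)}`; the representation is written as a restriction from `G_{𝕋_3}`.) -/
def rho (t : kˣ) : Representation k (Subgroup.centralizer {g12}) k :=
  (Algebra.lmul k k).toMonoidHom.comp ((Units.coeHom k).comp
    ((charConst 3 t).comp (Subgroup.centralizer {g12}).subtype))

theorem rho_g12 (t : kˣ) (x : k) :
    rho t ⟨g12, Subgroup.mem_centralizer_singleton_iff.2 rfl⟩ x = (t : k) * x := rfl

/-- The Yetter-Drinfeld module `M(g_{(1 2)}, ρ_t)` over `G_{𝕋_3}`. -/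
abbrev M (t : kˣ) : YetterDrinfeld k (Env 3) (YetterDrinfeld.Ind g12 (rho t)) :=
  YetterDrinfeld.ind g12 (rho t)

end

end TranspositionRack

end

open scoped TensorProduct

noncomputable section

/-! Both parts are governed by the sign of one identity: `1 + t ^ 3 = (t + 1) * (t ^ 2 - t + 1)`, so
the dichotomy is whether `t ^ 3 = -1`.

Index each transposition by the point it fixes. Then `V` has a basis with braiding `X x ⊗ X y ↦ t •
X (x ◃ y) ⊗ X x`, where `x ◃ y = -(x + y)` in `Fin 3`. The kernels of the braided symmetrizers form
the radical of the left skew derivations `d y`. On the Nichols algebra these derivations are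
therefore nondegenerate, and a subspace is a left coideal exactly when all `d y` preserve it
(`isLeftCoideal_iff`). The right derivations `e y` commute with the `d y` and have the same radical.

The quadratic element `relator a b` has a single nonzero derivative, `d a (relator a b) = (1 + t ^
3) • X b`.

If `t ^ 3 = -1`, the relator vanishes and gives commutation rules. The `G`-grading makes the linear
part of a left coideal subalgebra `C` a span of generators, and `eq_adjoin_of_d_mem` treats each
number of generators in `C`. With all three, `C` is everything; with none, it consists of scalars.
With exactly one, `C` is spanned by its powers (`mem_span_X_pow`). With all but `X c`, the
derivation `e c` kills `C`, and its kernel is the subalgebra generated by the other two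
(`mem_adjoinNe_of_e_eq_zero`).

If `t ^ 3 ≠ -1`, the algebra generated by `X b` and `relator a b` is stable under all `d y`, but its
linear part is only the line of `X b`. Since `d a` kills the powers of `X b` and not the relator, it
is not generated in degree one (`adjoin_relator_ne`). -/

/-! ### Induction and gradings on generated subalgebras -/

theorem Algebra.adjoin_left_induction {k A : Type*} [CommSemiring k] [Semiring A] [Algebra k A]
    {s : Set A} {P : A → Prop} (one : P 1) (smul : ∀ (r : k) u, P u → P (r • u))
    (add : ∀ u w, P u → P w → P (u + w)) (mul : ∀ x ∈ s, ∀ u, P u → P (x * u))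
    {u : A} (hu : u ∈ Algebra.adjoin k s) : P u := by
  have zero : P 0 := by simpa using smul 0 1 one
  -- The property "left multiplication by `u` preserves `P`" is closed under products, which `P`
  -- itself need not be.
  suffices h : ∀ w, P w → P (u * w) by simpa using h 1 one
  induction hu using Algebra.adjoin_induction with
  | mem x hx => exact mul x hx
  | algebraMap r => intro w hw; rw [← Algebra.smul_def]; exact smul r w hw
  | add x y _ _ hx hy => intro w hw; rw [add_mul]; exact add _ _ (hx w hw) (hy w hw)
  | mul x y _ _ hx hy => intro w hw; rw [mul_assoc]; exact hx _ (hy w hw)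

/-- A subalgebra generated by homogeneous elements is the sum of its homogeneous parts. -/
theorem Algebra.adjoin_le_iSup_inf {k A ι : Type*} [CommSemiring k] [Semiring A] [Algebra k A]
    [Monoid ι] (M : ι → Submodule k A) (one : 1 ∈ M 1)
    (mul : ∀ i j, ∀ x ∈ M i, ∀ y ∈ M j, x * y ∈ M (i * j)) {s : Set A}
    (hs : ∀ x ∈ s, ∃ i, x ∈ M i) :
    Subalgebra.toSubmodule (Algebra.adjoin k s) ≤
      ⨆ i, Subalgebra.toSubmodule (Algebra.adjoin k s) ⊓ M i := by
  intro u hu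
  refine Algebra.adjoin_left_induction (s := s)
    (P := fun u => u ∈ ⨆ i, Subalgebra.toSubmodule (Algebra.adjoin k s) ⊓ M i)
    ?_ (fun r u h => Submodule.smul_mem _ r h) (fun u w h h' => add_mem h h') ?_ hu
  · exact Submodule.mem_iSup_of_mem 1 ⟨one_mem (Algebra.adjoin k s), one⟩
  · intro x hx u h
    obtain ⟨i, hi⟩ := hs x hx
    induction h using Submodule.iSup_induction' with
    | mem j u hu =>
      exact Submodule.mem_iSup_of_mem (i * j)
        ⟨mul_mem (S := Subalgebra k A) (Algebra.subset_adjoin hx) hu.1, mul _ _ _ hi _ hu.2⟩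
    | zero => rw [mul_zero]; exact zero_mem _
    | add a b _ _ ha hb => rw [mul_add]; exact add_mem ha hb

/-! ### Skew derivations and their radical -/

/-- An algebra generated by elements `X x`, indexed by the rack of transpositions of `𝕊₃` (the
transposition fixing `x : Fin 3` has index `x`, so that `x ◃ y = -(x + y)`), with the
automorphisms `s x` given by the action of the enveloping group, an augmentation `ε`, and the left
and right skew derivations `d x` and `e x` belonging to the braiding
`X x ⊗ X y ↦ t • X (x ◃ y) ⊗ X x`. -/
structure BraidedDerivations {k : Type*} [Field k] (t : k) (A : Type*) [Ring A] [Algebra k A] where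
  X : Fin 3 → A
  s : Fin 3 → A →ₗ[k] A
  d : Fin 3 → A →ₗ[k] A
  e : Fin 3 → A →ₗ[k] A
  ε : A →ₗ[k] k
  adjoin_X : Algebra.adjoin k (Set.range X) = ⊤
  s_one : ∀ x, s x 1 = 1
  s_X_mul : ∀ x y u, s x (X y * u) = t • (X (-(x + y)) * s x u)
  d_one : ∀ y, d y 1 = 0
  d_X_mul : ∀ y x u, d y (X x * u) = (if x = y then u else 0) + t • (X x * d (-(x + y)) u)
  e_one : ∀ y, e y 1 = 0
  e_X_mul : ∀ y x u, e y (X x * u) = X x * e y u + if x = y then s y u else 0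
  ε_one : ε 1 = 1
  ε_X_mul : ∀ x u, ε (X x * u) = 0

namespace BraidedDerivations

theorem rack_eq_iff : ∀ x y z : Fin 3, -(x + y) = z ↔ y = -(x + z) := by decide

theorem rack_rack : ∀ x y : Fin 3, -(x + -(x + y)) = y := by decide

theorem rack_rack_right : ∀ x y : Fin 3, -(-(x + y) + y) = x := by decide

/-- Self-distributivity of `◃` combined with `x ◃ (x ◃ y) = y`. -/
theorem rack_distrib : ∀ x y z : Fin 3, -(x + -(-(x + y) + z)) = -(y + -(x + z)) := by decide

theorem rack_self : ∀ x : Fin 3, -(x + x) = x := by decide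

theorem rack_ne_left : ∀ x y : Fin 3, x ≠ y → -(x + y) ≠ x := by decide

theorem rack_ne_right : ∀ x y : Fin 3, x ≠ y → -(x + y) ≠ y := by decide

variable {k A : Type*} [Field k] {t : k} [Ring A] [Algebra k A] (S : BraidedDerivations t A)

@[elab_as_elim]
theorem induction {P : A → Prop} (u : A) (one : P 1) (smul : ∀ (r : k) u, P u → P (r • u))
    (add : ∀ u w, P u → P w → P (u + w)) (X_mul : ∀ x u, P u → P (S.X x * u)) : P u :=
  Algebra.adjoin_left_induction (k := k) (s := Set.range S.X) one smul add
    (by rintro _ ⟨x, rfl⟩ u h; exact X_mul x u h) (by rw [S.adjoin_X]; trivial)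

theorem s_X (x y : Fin 3) : S.s x (S.X y) = t • S.X (-(x + y)) := by
  simpa [s_one] using S.s_X_mul x y 1

theorem d_X (y x : Fin 3) : S.d y (S.X x) = if x = y then 1 else 0 := by
  simpa [d_one] using S.d_X_mul y x 1

theorem e_X (y x : Fin 3) : S.e y (S.X x) = if x = y then 1 else 0 := by
  simpa [e_one, s_one] using S.e_X_mul y x 1

theorem s_mul (x : Fin 3) (u w : A) : S.s x (u * w) = S.s x u * S.s x w := by
  induction u using S.induction with
  | one => simp [s_one]
  | smul r u h => simp [h]
  | add u u' h h' => simp [add_mul, h, h']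
  | X_mul y u h => simp [mul_assoc, s_X_mul, h]

theorem s_pow (x : Fin 3) (u : A) (n : ℕ) : S.s x (u ^ n) = S.s x u ^ n := by
  induction n with
  | zero => simp [s_one]
  | succ n ih => rw [pow_succ, pow_succ, s_mul, ih]

theorem ε_mul (u w : A) : S.ε (u * w) = S.ε u * S.ε w := by
  induction u using S.induction with
  | one => simp [ε_one]
  | smul r u h => simp [h, mul_assoc]
  | add u u' h h' => simp [add_mul, h, h']
  | X_mul y u h => simp [mul_assoc, ε_X_mul]

/-- The twist `s y` is an algebra map that depends only on `y`, so the rule extends from generators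
to arbitrary left factors. For `d`, the index itself changes with the factor that is passed; this is
why the ideal property of the radical is proved with `e`. -/
theorem e_mul (y : Fin 3) (u w : A) : S.e y (u * w) = u * S.e y w + S.e y u * S.s y w := by
  induction u using S.induction with
  | one => simp [e_one]
  | smul r u h => simp [h]
  | add u u' h h' => simp only [add_mul, map_add, h, h']; abel
  | X_mul x u h =>
    rw [mul_assoc, e_X_mul, e_X_mul, h]
    split_ifs <;> simp only [mul_add, add_mul, mul_assoc, s_mul, add_zero]
    abel

theorem d_s (y x : Fin 3) (u : A) : S.d y (S.s x u) = t • S.s x (S.d (-(x + y)) u) := by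
  induction u using S.induction generalizing y with
  | one => simp [d_one, s_one]
  | smul r u h => simp [h, smul_comm r t]
  | add u u' h h' => simp [h, h']
  | X_mul z u h =>
    rw [s_X_mul, map_smul, d_X_mul, h, d_X_mul, map_add, map_smul, s_X_mul, rack_distrib]
    simp only [rack_eq_iff]
    split_ifs <;> simp

/-- Coassociativity in disguise: `d` and `e` split off generators at opposite ends. The only
interaction is `d` acting on the twisted term `s z u`, which `d_s` resolves. -/
theorem d_e (y z : Fin 3) (u : A) : S.d y (S.e z u) = S.e z (S.d y u) := by
  induction u using S.induction generalizing y with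
  | one => simp [d_one, e_one]
  | smul r u h => simp [h]
  | add u u' h h' => simp [h, h']
  | X_mul x u h =>
    rw [e_X_mul, d_X_mul, map_add, map_add, d_X_mul, map_smul, e_X_mul, h]
    split_ifs with h1 h2 h2
    · rw [d_s, smul_add, h2]; abel
    · simp
    · rw [d_s, smul_add, h2, map_zero, zero_add, zero_add]
    · simp

theorem ε_s (x : Fin 3) (u : A) : S.ε (S.s x u) = S.ε u := by
  induction u using S.induction with
  | one => simp [s_one]
  | smul r u h => simp [h]
  | add u u' h h' => simp [h, h']
  | X_mul z u h => simp [s_X_mul, ε_X_mul]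

theorem ε_e (x : Fin 3) (u : A) : S.ε (S.e x u) = S.ε (S.d x u) := by
  induction u using S.induction with
  | one => simp [d_one, e_one]
  | smul r u h => simp [h]
  | add u u' h h' => simp [h, h']
  | X_mul z u h =>
    rw [e_X_mul, d_X_mul]
    split_ifs <;> simp [ε_X_mul, ε_s]

/-- The composition of left skew derivations along a word. -/
def dWord : List (Fin 3) → A →ₗ[k] A
  | [] => LinearMap.id
  | y :: l => dWord l ∘ₗ S.d y

/-- The composition of right skew derivations along a word. -/
def eWord : List (Fin 3) → A →ₗ[k] A
  | [] => LinearMap.id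
  | y :: l => eWord l ∘ₗ S.e y

@[simp] theorem dWord_nil (u : A) : S.dWord [] u = u := rfl

@[simp] theorem dWord_cons (y : Fin 3) (l : List (Fin 3)) (u : A) :
    S.dWord (y :: l) u = S.dWord l (S.d y u) := rfl

@[simp] theorem eWord_nil (u : A) : S.eWord [] u = u := rfl

@[simp] theorem eWord_cons (y : Fin 3) (l : List (Fin 3)) (u : A) :
    S.eWord (y :: l) u = S.eWord l (S.e y u) := rfl

theorem eWord_append (l m : List (Fin 3)) (u : A) :
    S.eWord (l ++ m) u = S.eWord m (S.eWord l u) := by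
  induction l generalizing u with
  | nil => rfl
  | cons y l ih => simp [ih]

theorem d_eWord (y : Fin 3) (l : List (Fin 3)) (u : A) :
    S.d y (S.eWord l u) = S.eWord l (S.d y u) := by
  induction l generalizing u with
  | nil => rfl
  | cons z l ih => simp [ih, d_e]

theorem ε_eWord_append (l : List (Fin 3)) (y : Fin 3) (u : A) :
    S.ε (S.eWord (l ++ [y]) u) = S.ε (S.eWord l (S.d y u)) := by
  rw [eWord_append, eWord_cons, eWord_nil, ε_e, d_eWord]

/-- Under `ε` the last right derivation may be replaced by a left one, which then commutes to the
front of the word. Hence left and right derivations define the same radical. -/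
theorem ε_eWord_reverse (l : List (Fin 3)) (u : A) :
    S.ε (S.eWord l.reverse u) = S.ε (S.dWord l u) := by
  induction l generalizing u with
  | nil => rfl
  | cons y l ih => rw [List.reverse_cons, ε_eWord_append, ih, dWord_cons]

/-- The elements annihilated by all iterated skew derivations followed by the augmentation. -/
def radical : Submodule k A := ⨅ l, LinearMap.ker (S.ε ∘ₗ S.dWord l)

theorem mem_radical {u : A} : u ∈ S.radical ↔ ∀ l, S.ε (S.dWord l u) = 0 := by
  simp [radical]

theorem mem_radical_iff_eWord {u : A} : u ∈ S.radical ↔ ∀ l, S.ε (S.eWord l u) = 0 := by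
  rw [mem_radical]
  constructor
  · intro h l
    rw [← l.reverse_reverse, ε_eWord_reverse, h]
  · intro h l
    rw [← ε_eWord_reverse, h]

theorem mem_radical_iff {u : A} : u ∈ S.radical ↔ S.ε u = 0 ∧ ∀ y, S.d y u ∈ S.radical := by
  simp only [mem_radical]
  constructor
  · exact fun h => ⟨h [], fun y l => h (y :: l)⟩
  · rintro ⟨h, h'⟩ (_ | ⟨y, l⟩)
    exacts [h, h' y l]

theorem mem_radical_iff_e {u : A} : u ∈ S.radical ↔ S.ε u = 0 ∧ ∀ y, S.e y u ∈ S.radical := by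
  simp only [mem_radical_iff_eWord]
  constructor
  · exact fun h => ⟨h [], fun y l => h (y :: l)⟩
  · rintro ⟨h, h'⟩ (_ | ⟨y, l⟩)
    exacts [h, h' y l]

theorem mem_radical_of_stable {P : A → Prop} (h : ∀ u, P u → S.ε u = 0)
    (hd : ∀ u y, P u → P (S.d y u)) {u : A} (hu : P u) : u ∈ S.radical := by
  rw [mem_radical]
  intro l
  induction l generalizing u with
  | nil => exact h u hu
  | cons y l ih => exact ih (hd u y hu)

theorem s_mem_radical (x : Fin 3) {u : A} (hu : u ∈ S.radical) : S.s x u ∈ S.radical := by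
  refine S.mem_radical_of_stable (P := fun w => ∃ u ∈ S.radical, S.s x u = w) ?_ ?_ ⟨u, hu, rfl⟩
  · rintro _ ⟨u, hu, rfl⟩
    rw [ε_s, (S.mem_radical_iff.1 hu).1]
  · rintro _ y ⟨u, hu, rfl⟩
    exact ⟨t • S.d (-(x + y)) u, Submodule.smul_mem _ _ ((S.mem_radical_iff.1 hu).2 _),
      by rw [d_s, map_smul]⟩

/-- By `e_mul`, a right derivative of a product is a sum of products in which the factor from the
radical is kept, differentiated or twisted by `s y`; all three stay in the radical. -/
theorem ε_eWord_mul (l : List (Fin 3)) (u w : A) (h : u ∈ S.radical ∨ w ∈ S.radical) :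
    S.ε (S.eWord l (u * w)) = 0 := by
  induction l generalizing u w with
  | nil =>
    rw [eWord_nil, ε_mul]
    rcases h with h | h <;> simp [(S.mem_radical_iff.1 h).1]
  | cons y l ih =>
    rw [eWord_cons, e_mul, map_add, map_add, ih, ih, add_zero]
    · exact h.imp (fun h => (S.mem_radical_iff_e.1 h).2 y) (S.s_mem_radical y)
    · exact h.imp id fun h => (S.mem_radical_iff_e.1 h).2 y

theorem mul_mem_radical {u w : A} (h : u ∈ S.radical ∨ w ∈ S.radical) : u * w ∈ S.radical :=
  S.mem_radical_iff_eWord.2 fun l => S.ε_eWord_mul l u w h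

/-- The radical as a two-sided ideal. -/
def radicalIdeal : TwoSidedIdeal A :=
  TwoSidedIdeal.mk' S.radical (zero_mem _) add_mem neg_mem
    (fun h => S.mul_mem_radical (.inr h)) (fun h => S.mul_mem_radical (.inl h))

theorem mem_radicalIdeal {u : A} : u ∈ S.radicalIdeal ↔ u ∈ S.radical :=
  TwoSidedIdeal.mem_mk' ..

theorem ext_of_surjective {B N : Type*} [AddCommGroup B] [Module k B] [AddCommGroup N] [Module k N]
    {π : A →ₗ[k] B} (hπ : Function.Surjective π) (f : A →ₗ[k] N)
    (hf : ∀ u, π u = 0 → f u = 0) : ∃ g : B →ₗ[k] N, ∀ u, g (π u) = f u := by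
  obtain ⟨σ, hσ⟩ := π.exists_rightInverse_of_surjective (LinearMap.range_eq_top.2 hπ)
  refine ⟨f ∘ₗ σ, fun u => ?_⟩
  have h := hf (σ (π u) - u) (by
    rw [map_sub, sub_eq_zero]; exact LinearMap.congr_fun hσ (π u))
  rwa [map_sub, sub_eq_zero] at h

/-- The structure induced on the quotient by the radical. -/
theorem exists_quotient {B : Type*} [Ring B] [Algebra k B] (π : A →ₐ[k] B)
    (hπ : Function.Surjective π) (hker : ∀ u, π u = 0 ↔ u ∈ S.radical) :
    ∃ R : BraidedDerivations t B, (∀ x, R.X x = π (S.X x)) ∧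
      (∀ y u, R.d y (π u) = π (S.d y u)) ∧ (∀ u, R.ε (π u) = S.ε u) ∧ R.radical = ⊥ := by
  have hs (x) := ext_of_surjective (π := π.toLinearMap) hπ (π.toLinearMap ∘ₗ S.s x)
    fun u hu => (hker _).2 (S.s_mem_radical x ((hker u).1 hu))
  have hd (x) := ext_of_surjective (π := π.toLinearMap) hπ (π.toLinearMap ∘ₗ S.d x)
    fun u hu => (hker _).2 ((S.mem_radical_iff.1 ((hker u).1 hu)).2 x)
  have he (x) := ext_of_surjective (π := π.toLinearMap) hπ (π.toLinearMap ∘ₗ S.e x)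
    fun u hu => (hker _).2 ((S.mem_radical_iff_e.1 ((hker u).1 hu)).2 x)
  obtain ⟨ε, hε⟩ := ext_of_surjective (π := π.toLinearMap) hπ S.ε
    fun u hu => (S.mem_radical_iff.1 ((hker u).1 hu)).1
  choose s hs using hs
  choose d hd using hd
  choose e he using he
  simp only [AlgHom.toLinearMap_apply, LinearMap.comp_apply] at hs hd he hε
  let R : BraidedDerivations t B :=
    { X := fun x => π (S.X x)
      s := s, d := d, e := e, ε := ε
      adjoin_X := by
        have := congrArg (Subalgebra.map π) S.adjoin_X
        rw [AlgHom.map_adjoin, Algebra.map_top, (AlgHom.range_eq_top π).2 hπ, ← Set.range_comp]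
          at this
        exact this
      s_one := fun x => by rw [← map_one π, hs, s_one]
      s_X_mul := fun x y u => by
        obtain ⟨u, rfl⟩ := hπ u
        rw [← map_mul, hs, hs, s_X_mul, map_smul, map_mul]
      d_one := fun x => by rw [← map_one π, hd, d_one, map_zero]
      d_X_mul := fun x y u => by
        obtain ⟨u, rfl⟩ := hπ u
        rw [← map_mul, hd, hd, d_X_mul, map_add, map_smul, map_mul]
        split_ifs <;> simp
      e_one := fun x => by rw [← map_one π, he, e_one, map_zero]
      e_X_mul := fun x y u => by
        obtain ⟨u, rfl⟩ := hπ u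
        rw [← map_mul, he, he, hs, e_X_mul, map_add, map_mul]
        split_ifs <;> simp
      ε_one := by rw [← map_one π, hε, ε_one]
      ε_X_mul := fun x u => by
        obtain ⟨u, rfl⟩ := hπ u
        rw [← map_mul, hε, ε_X_mul] }
  refine ⟨R, fun x => rfl, hd, hε, ?_⟩
  rw [eq_bot_iff]
  intro u hu
  obtain ⟨u, rfl⟩ := hπ u
  rw [mem_radical] at hu
  rw [Submodule.mem_bot, hker, mem_radical]
  intro l
  have h : ∀ u, R.dWord l (π u) = π (S.dWord l u) := by
    induction l with
    | nil => intro u; rfl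
    | cons y l ih => intro u; rw [dWord_cons, dWord_cons, ← ih]; exact congrArg _ (hd y u)
  have := hu l
  rw [h] at this
  rw [← hε]; exact this

end BraidedDerivations

namespace BraidedDerivations

variable {k A : Type*} [Field k] {t : k} [Ring A] [Algebra k A] (S : BraidedDerivations t A)

/-! ### Degrees -/

/-- The span of the generators. -/
def gens : Submodule k A := Submodule.span k (Set.range S.X)

theorem X_mem_gens (x : Fin 3) : S.X x ∈ S.gens := Submodule.subset_span ⟨x, rfl⟩

theorem gens_pow_induction {n : ℕ} {P : A → Prop} (zero : P 0)
    (add : ∀ u w, P u → P w → P (u + w)) (X_mul : ∀ x, ∀ u ∈ S.gens ^ n, P (S.X x * u)) {u : A}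
    (hu : u ∈ S.gens ^ (n + 1)) : P u := by
  rw [pow_succ'] at hu
  induction hu using Submodule.mul_induction_on' with
  | mem_mul_mem x hx u hu =>
    induction hx using Submodule.span_induction generalizing u with
    | mem x hx => obtain ⟨x, rfl⟩ := hx; exact X_mul x u hu
    | zero => rwa [zero_mul]
    | add x y _ _ hx hy => rw [add_mul]; exact add _ _ (hx u hu) (hy u hu)
    | smul r x _ hx =>
      rw [smul_mul_assoc, ← mul_smul_comm]; exact hx _ (Submodule.smul_mem _ r hu)
  | add x _ y _ hx hy => exact add _ _ hx hy

theorem mem_gens_pow_zero {u : A} (hu : u ∈ S.gens ^ 0) : u = S.ε u • 1 := by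
  rw [pow_zero, Submodule.mem_one] at hu
  obtain ⟨r, rfl⟩ := hu
  simp [Algebra.algebraMap_eq_smul_one, ε_one]

theorem ε_of_mem_gens_pow {n : ℕ} {u : A} (hu : u ∈ S.gens ^ (n + 1)) : S.ε u = 0 :=
  S.gens_pow_induction (P := fun u => S.ε u = 0) (map_zero _)
    (fun u w h h' => by rw [map_add, h, h', add_zero]) (fun x u _ => S.ε_X_mul x u) hu

theorem d_mem_gens_pow (y : Fin 3) {n : ℕ} {u : A} (hu : u ∈ S.gens ^ (n + 1)) :
    S.d y u ∈ S.gens ^ n := by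
  induction n generalizing u y with
  | zero =>
    refine S.gens_pow_induction (P := fun u => S.d y u ∈ S.gens ^ 0) (by simp)
      (fun u w h h' => by rw [map_add]; exact add_mem h h') (fun x u hu => ?_) hu
    rw [S.mem_gens_pow_zero hu, mul_smul_comm, mul_one, map_smul, d_X]
    refine Submodule.smul_mem _ _ ?_
    split_ifs
    · rw [pow_zero]; exact Submodule.one_le.1 le_rfl
    · exact zero_mem _
  | succ n ih =>
    refine S.gens_pow_induction (P := fun u => S.d y u ∈ S.gens ^ (n + 1)) (by simp)
      (fun u w h h' => by rw [map_add]; exact add_mem h h') (fun x u hu => ?_) hu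
    rw [d_X_mul]
    refine add_mem ?_ (Submodule.smul_mem _ _ ?_)
    · split_ifs
      · exact hu
      · exact zero_mem _
    · rw [pow_succ']
      exact Submodule.mul_mem_mul (S.X_mem_gens x) (ih _ hu)

theorem eq_sum_of_mem_gens {u : A} (hu : u ∈ S.gens) : u = ∑ x, S.ε (S.d x u) • S.X x := by
  induction hu using Submodule.span_induction with
  | mem u hu => 
    obtain ⟨x, rfl⟩ := hu
    simp [d_X, apply_ite S.ε, ε_one]
  | zero => simp
  | add u w _ _ h h' =>
    conv_lhs => rw [h, h']
    simp [add_smul, Finset.sum_add_distrib]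
  | smul r u _ h =>
    conv_lhs => rw [h]
    simp [Finset.smul_sum, smul_smul]

/-! ### Nondegenerate case -/

variable {S} (hS : S.radical = ⊥)

include hS in
theorem eq_zero_of_d {u : A} (hu : S.ε u = 0) (hd : ∀ y, S.d y u = 0) : u = 0 := by
  rw [← Submodule.mem_bot k, ← hS, mem_radical_iff]
  exact ⟨hu, fun y => by rw [hd]; exact zero_mem _⟩


theorem gens_pow_zero_mem (C : Subalgebra k A) {u : A} (hu : u ∈ S.gens ^ 0) : u ∈ C := by
  rw [S.mem_gens_pow_zero hu]
  exact C.smul_mem (one_mem C) _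

include hS in
theorem mem_of_d_eq_zero (C : Subalgebra k A) {u : A} (hd : ∀ y, S.d y u = 0) : u ∈ C := by
  have h : u - S.ε u • 1 = 0 :=
    eq_zero_of_d hS (by simp [ε_one]) (fun y => by simp [hd, d_one])
  rw [sub_eq_zero.1 h]
  exact C.smul_mem (one_mem C) _

include hS in
-- By `d_s` and `t ≠ 0` the kernel of `s x` is stable under all `d y`; it is also killed by `ε`, so
-- it lies in the radical.
theorem s_injective (ht : t ≠ 0) (x : Fin 3) : Function.Injective (S.s x) := by
  rw [injective_iff_map_eq_zero]
  intro u hu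
  rw [← Submodule.mem_bot k, ← hS]
  refine S.mem_radical_of_stable (P := fun u => S.s x u = 0) (fun u hu => ?_) (fun u y hu => ?_) hu
  · rw [← S.ε_s x, hu, map_zero]
  · have h := S.d_s (-(x + y)) x u
    rw [hu, map_zero, rack_rack, eq_comm, smul_eq_zero_iff_right ht] at h
    exact h

/-! ### Powers of a generator -/

/-- The quantum integer `1 + q + ⋯ + q ^ (n - 1)`. -/
def qInt (q : k) (n : ℕ) : k := ∑ i ∈ Finset.range n, q ^ i

theorem qInt_succ (q : k) (n : ℕ) : qInt q (n + 1) = qInt q n + q ^ n :=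
  Finset.sum_range_succ _ _

theorem qInt_succ' (q : k) (n : ℕ) : qInt q (n + 1) = 1 + q * qInt q n := by
  rw [qInt, geom_sum_succ, add_comm]; rfl

/-- The quantum factorial. -/
def qFactorial (q : k) (n : ℕ) : k := ∏ i ∈ Finset.range n, qInt q (i + 1)

theorem qFactorial_succ (q : k) (n : ℕ) :
    qFactorial q (n + 1) = qFactorial q n * qInt q (n + 1) :=
  Finset.prod_range_succ _ _

variable (S) in
theorem d_X_pow (y x : Fin 3) (n : ℕ) :
    S.d y (S.X x ^ (n + 1)) = if x = y then qInt t (n + 1) • S.X x ^ n else 0 := by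
  induction n generalizing y with
  | zero => simp [d_X, qInt]
  | succ n ih =>
    rw [pow_succ', d_X_mul, ih]
    by_cases h : x = y
    · subst h
      rw [rack_self, if_pos rfl, if_pos rfl, if_pos rfl, mul_smul_comm, ← pow_succ', smul_smul,
        qInt_succ' t (n + 1), add_smul, one_smul]
    · rw [if_neg h, if_neg h, if_neg (rack_ne_left x y h).symm]
      simp

variable (S) in
theorem d_pow_X_mul_self (y : Fin 3) (n : ℕ) (u : A) :
    (S.d y ^ (n + 1)) (S.X y * u) =
      t ^ (n + 1) • (S.X y * (S.d y ^ (n + 1)) u) + qInt t (n + 1) • (S.d y ^ n) u := by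
  induction n with
  | zero => simp only [zero_add, pow_one, pow_zero, d_X_mul, rack_self, if_true, qInt,
      Finset.sum_range_one, one_smul, Module.End.one_apply, add_comm]
  | succ n ih =>
    rw [pow_succ', Module.End.mul_apply, ih, map_add, map_smul, map_smul, d_X_mul, rack_self,
      if_pos rfl, ← Module.End.mul_apply, ← pow_succ', ← Module.End.mul_apply, ← pow_succ',
      qInt_succ t (n + 1), pow_succ t (n + 1)]
    module

variable (S) in
theorem d_pow_X_mul (y x : Fin 3) (h : x ≠ y) (n : ℕ) (u : A) :
    (S.d y ^ n) (S.X x * u) = t ^ n • (S.X x * (S.d (-(x + y)) ^ n) u) := by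
  induction n generalizing u with
  | zero => simp
  | succ n ih =>
    rw [pow_succ, Module.End.mul_apply, d_X_mul, if_neg h, zero_add, map_smul, ih, smul_smul,
      ← pow_succ', pow_succ (S.d _), Module.End.mul_apply]

variable (S) in
-- The only term of `d_pow_X_mul_self` with a lower power of `d y` carries the factor `qInt t (n +
-- 1)`. Passing another generator changes `y`, so the induction runs over all `y` at once.
theorem d_pow_eq_zero {n : ℕ} (h : qInt t (n + 1) = 0) (y : Fin 3) (u : A) :
    (S.d y ^ (n + 1)) u = 0 := by
  induction u using S.induction generalizing y with
  | one => rw [pow_succ, Module.End.mul_apply, d_one, map_zero]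
  | smul r u hu => rw [map_smul, hu, smul_zero]
  | add u w hu hw => rw [map_add, hu, hw, add_zero]
  | X_mul x u hu =>
    by_cases hx : x = y
    · subst hx; rw [d_pow_X_mul_self, hu, h]; simp
    · rw [d_pow_X_mul S y x hx, hu]; simp

variable (S) in
theorem d_pow_X_pow (y : Fin 3) (n : ℕ) :
    (S.d y ^ n) (S.X y ^ n) = qFactorial t n • 1 := by
  induction n with
  | zero => simp [qFactorial]
  | succ n ih =>
    rw [pow_succ, Module.End.mul_apply, d_X_pow, if_pos rfl, map_smul, ih, smul_smul,
      qFactorial_succ, mul_comm]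

include hS in
theorem X_pow_eq_zero (x : Fin 3) {n : ℕ} (h : qFactorial t n = 0) : S.X x ^ n = 0 := by
  induction n with
  | zero => simp [qFactorial] at h
  | succ n ih =>
    rw [qFactorial_succ, mul_eq_zero] at h
    rcases h with h | h
    · rw [pow_succ, ih h, zero_mul]
    · refine eq_zero_of_d hS (by rw [pow_succ', ε_X_mul]) fun y => ?_
      rw [d_X_pow, h]; simp

/-! ### Quadratic relations -/

variable (S) in
/-- The quadratic element that vanishes if `t ^ 3 = -1`. -/
def relator (a b : Fin 3) : A :=
  S.X a * S.X b - t • (S.X (-(a + b)) * S.X a) + t ^ 2 • (S.X b * S.X (-(a + b)))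

variable (S) in
-- The coefficients `1, -t, t ^ 2` make the first-order terms cancel for two of the three
-- derivations; for `p = a` the first and last monomials contribute `X b` and `t ^ 3 • X b`.
theorem d_relator_mul (a b p : Fin 3) (h : a ≠ b) (u : A) :
    S.d p (S.relator a b * u) = (if a = p then (1 + t ^ 3) • (S.X b * u) else 0) +
      t ^ 2 • (S.relator a b * S.d (-(b + -(a + p))) u) := by
  simp only [relator, add_mul, sub_mul, smul_mul_assoc, mul_assoc, map_add, map_sub, map_smul,
    d_X_mul]
  fin_cases a <;> fin_cases b <;> first | exact absurd rfl h | skip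
  all_goals
    fin_cases p <;> simp [show (-1 : Fin 3) = 2 from rfl, show (-2 : Fin 3) = 1 from rfl,
      show (1 + 2 : Fin 3) = 0 from rfl, show (2 + 1 : Fin 3) = 0 from rfl,
      show (1 + 1 : Fin 3) = 2 from rfl, show (2 + 2 : Fin 3) = 1 from rfl, mul_add]
  all_goals module

include hS in
theorem relation (ht : t ^ 3 = -1) (x y : Fin 3) (h : x ≠ y) :
    S.X x * S.X y - t • (S.X (-(x + y)) * S.X x) + t ^ 2 • (S.X y * S.X (-(x + y))) = 0 := by
  refine eq_zero_of_d hS (by simp [ε_X_mul]) fun p => ?_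
  have h1 := d_relator_mul S x y p h 1
  rw [mul_one, d_one, ht, add_neg_cancel, zero_smul, ite_self, mul_zero, smul_zero, add_zero] at h1
  exact h1

variable (S) in
-- The quadratic relation for the operators `d`, dual to `relation`. It is a compatibility condition
-- on the derivatives of one element, used to bound how many of them can be nonzero.
theorem d_relation (ht : t ^ 3 = -1) (x y : Fin 3) (h : x ≠ y) (u : A) :
    t • S.d y (S.d x u) - S.d x (S.d (-(x + y)) u) - t ^ 2 • S.d (-(x + y)) (S.d y u) = 0 := by
  induction u using S.induction generalizing x y with
  | one => simp [d_one]
  | smul r u hu =>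
    simp only [map_smul]
    linear_combination (norm := module) r • hu x y h
  | add u w hu hw =>
    simp only [map_add]
    linear_combination (norm := module) hu x y h + hw x y h
  | X_mul p u hu =>
    -- Moving `d` past `X p` applies `p ◃ ·` to the indices, so the induction hypothesis is needed
    -- at the translated pair.
    have h' : -(p + x) ≠ -(p + y) := fun e => h (add_left_cancel (neg_injective e))
    have hu' := congrArg (S.X p * ·) (hu _ _ h')
    simp only [mul_sub, mul_smul_comm, mul_zero] at hu'
    simp only [d_X_mul, map_add, map_smul]
    fin_cases x <;> fin_cases y <;> first | exact absurd rfl h | skip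
    all_goals
      fin_cases p
      all_goals
        simp [show (-1 : Fin 3) = 2 from rfl, show (-2 : Fin 3) = 1 from rfl,
          show (1 + 2 : Fin 3) = 0 from rfl, show (2 + 1 : Fin 3) = 0 from rfl,
          show (1 + 1 : Fin 3) = 2 from rfl, show (2 + 2 : Fin 3) = 1 from rfl] at hu' ⊢
        -- The terms not starting with `X p` cancel for every `t`, except when `p = x ◃ y`; there
        -- they sum to `-(1 + t ^ 3) • d x u`.
        first
        | linear_combination (norm := module) t ^ 2 • hu'
        | linear_combination (norm := module) t ^ 2 • hu' - ht • S.d 0 u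
        | linear_combination (norm := module) t ^ 2 • hu' - ht • S.d 1 u
        | linear_combination (norm := module) t ^ 2 • hu' - ht • S.d 2 u

end BraidedDerivations

namespace BraidedDerivations

variable {k A : Type*} [Field k] {t : k} [Ring A] [Algebra k A] (S : BraidedDerivations t A)

/-! ### The subalgebra generated by all generators but one -/

/-- The subalgebra generated by the generators different from `X c`. -/
def adjoinNe (c : Fin 3) : Subalgebra k A := Algebra.adjoin k {u | ∃ x, x ≠ c ∧ u = S.X x}

theorem X_mem_adjoinNe {c x : Fin 3} (h : x ≠ c) : S.X x ∈ S.adjoinNe c :=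
  Algebra.subset_adjoin ⟨x, h, rfl⟩

theorem s_mem_adjoinNe {c : Fin 3} {u : A} (hu : u ∈ S.adjoinNe c) : S.s c u ∈ S.adjoinNe c := by
  refine Algebra.adjoin_left_induction (P := fun u => S.s c u ∈ S.adjoinNe c) ?_ ?_ ?_ ?_ hu
  · rw [s_one]; exact one_mem _
  · intro r u h; rw [map_smul]; exact Subalgebra.smul_mem _ h r
  · intro u w h h'; rw [map_add]; exact add_mem h h'
  · rintro _ ⟨x, hx, rfl⟩ u h
    rw [s_X_mul]
    exact Subalgebra.smul_mem _ (mul_mem (S.X_mem_adjoinNe (rack_ne_left c x hx.symm)) h) t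

theorem e_adjoinNe {c : Fin 3} {u : A} (hu : u ∈ S.adjoinNe c) : S.e c u = 0 := by
  refine Algebra.adjoin_left_induction (P := fun u => S.e c u = 0) (S.e_one c) ?_ ?_ ?_ hu
  · intro r u h; rw [map_smul, h, smul_zero]
  · intro u w h h'; rw [map_add, h, h', add_zero]
  · rintro _ ⟨x, hx, rfl⟩ u h
    rw [e_X_mul, h, if_neg hx, mul_zero, add_zero]

theorem e_X_pow (c : Fin 3) (n : ℕ) : S.e c (S.X c ^ (n + 1)) = qInt t (n + 1) • S.X c ^ n := by
  induction n with
  | zero => simp [e_X, qInt]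
  | succ n ih =>
    rw [pow_succ', e_X_mul, ih, if_pos rfl, s_pow, s_X, rack_self, smul_pow, mul_smul_comm,
      ← pow_succ', ← add_smul, ← qInt_succ]

theorem e_X_pow_mul (c : Fin 3) (n : ℕ) {u : A} (hu : u ∈ S.adjoinNe c) :
    S.e c (S.X c ^ (n + 1) * u) = qInt t (n + 1) • (S.X c ^ n * S.s c u) := by
  rw [e_mul, S.e_adjoinNe hu, e_X_pow, mul_zero, zero_add, smul_mul_assoc]

/-- The sum of the subspaces `X c ^ i * K`, `i < n`, where `K = S.adjoinNe c`. -/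
def powFiltration (c : Fin 3) : ℕ → Submodule k A
  | 0 => ⊥
  | n + 1 => powFiltration c n ⊔
      (Subalgebra.toSubmodule (S.adjoinNe c)).map (LinearMap.mulLeft k (S.X c ^ n))

theorem mem_powFiltration_succ {c : Fin 3} {n : ℕ} {u : A} :
    u ∈ S.powFiltration c (n + 1) ↔
      ∃ w ∈ S.powFiltration c n, ∃ a ∈ S.adjoinNe c, w + S.X c ^ n * a = u := by
  simp [powFiltration, Submodule.mem_sup]

theorem powFiltration_mono (c : Fin 3) : Monotone (S.powFiltration c) :=
  monotone_nat_of_le_succ fun _ => le_sup_left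

theorem X_pow_mul_mem_powFiltration {c : Fin 3} (n : ℕ) {a : A} (ha : a ∈ S.adjoinNe c) :
    S.X c ^ n * a ∈ S.powFiltration c (n + 1) :=
  S.mem_powFiltration_succ.2 ⟨0, zero_mem _, a, ha, zero_add _⟩

theorem X_mul_powFiltration_le {c : Fin 3} {n : ℕ} {u : A} (hu : u ∈ S.powFiltration c n) :
    S.X c * u ∈ S.powFiltration c (n + 1) := by
  induction n generalizing u with
  | zero => rw [(Submodule.mem_bot k).1 hu, mul_zero]; exact zero_mem _
  | succ n ih =>
    obtain ⟨w, hw, a, ha, rfl⟩ := S.mem_powFiltration_succ.1 hu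
    rw [mul_add, ← mul_assoc, ← pow_succ']
    exact add_mem (S.powFiltration_mono c (Nat.le_succ _) (ih hw))
      (S.X_pow_mul_mem_powFiltration _ ha)

theorem e_mem_powFiltration {c : Fin 3} {n : ℕ} {u : A} (hu : u ∈ S.powFiltration c (n + 1)) :
    S.e c u ∈ S.powFiltration c n := by
  induction n generalizing u with
  | zero =>
    obtain ⟨w, hw, a, ha, rfl⟩ := S.mem_powFiltration_succ.1 hu
    rw [(Submodule.mem_bot k).1 hw, pow_zero, one_mul, zero_add, S.e_adjoinNe ha]
    exact zero_mem _
  | succ n ih =>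
    obtain ⟨w, hw, a, ha, rfl⟩ := S.mem_powFiltration_succ.1 hu
    rw [map_add, S.e_X_pow_mul c n ha]
    exact add_mem (S.powFiltration_mono c n.le_succ (ih hw))
      (Submodule.smul_mem _ _ (S.X_pow_mul_mem_powFiltration n (S.s_mem_adjoinNe ha)))

theorem e_pow_powFiltration {c : Fin 3} {n : ℕ} {u : A} (hu : u ∈ S.powFiltration c n) :
    (S.e c ^ n) u = 0 := by
  induction n generalizing u with
  | zero => exact hu
  | succ n ih => rw [pow_succ, Module.End.mul_apply]; exact ih (S.e_mem_powFiltration hu)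

theorem e_pow_X_pow_mul (c : Fin 3) (n : ℕ) {a : A} (ha : a ∈ S.adjoinNe c) :
    (S.e c ^ n) (S.X c ^ n * a) = qFactorial t n • (S.s c ^ n) a := by
  induction n generalizing a with
  | zero => simp [qFactorial]
  | succ n ih =>
    rw [pow_succ, Module.End.mul_apply, e_X_pow_mul S c n ha, map_smul, ih (S.s_mem_adjoinNe ha),
      smul_smul, qFactorial_succ, mul_comm, pow_succ (S.s c), Module.End.mul_apply]

variable {S} (hS : S.radical = ⊥)

include hS in
-- Applying `e c ^ n` to an element with top term `X c ^ n * a` leaves `qFactorial t n • (s c ^ n)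
-- a`. If this is zero, either `X c ^ n = 0` or `a = 0`, so the top term drops out and the
-- filtration index decreases.
theorem mem_adjoinNe_of_mem_powFiltration (ht : t ≠ 0) {c : Fin 3} {n : ℕ} {u : A}
    (hu : u ∈ S.powFiltration c n) (he : S.e c u = 0) : u ∈ S.adjoinNe c := by
  induction n generalizing u with
  | zero => rw [(Submodule.mem_bot k).1 hu]; exact zero_mem _
  | succ n ih =>
    obtain ⟨w, hw, a, ha, rfl⟩ := S.mem_powFiltration_succ.1 hu
    rcases n with _ | n
    · rw [(Submodule.mem_bot k).1 hw, pow_zero, one_mul, zero_add]; exact ha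
    · have h : (S.e c ^ (n + 1)) (w + S.X c ^ (n + 1) * a) = 0 := by
        rw [pow_succ, Module.End.mul_apply, he, map_zero]
      rw [map_add, S.e_pow_powFiltration hw, zero_add, S.e_pow_X_pow_mul c _ ha, smul_eq_zero] at h
      have h0 : S.X c ^ (n + 1) * a = 0 := by
        rcases h with h | h
        · rw [X_pow_eq_zero hS c h, zero_mul]
        · have hinj : Function.Injective (S.s c ^ (n + 1)) := by
            rw [Module.End.coe_pow]; exact (s_injective hS ht c).iterate _
          rw [hinj (h.trans (map_zero _).symm), mul_zero]
      rw [h0, add_zero] at he ⊢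
      exact ih hw he

include hS in
-- The quadratic relation rewrites `X x * X c` through `X c * X p` and `X p * X x` with `p = c ◃ x ≠
-- c`, so powers of `X c` can be moved to the left without growing.
theorem X_mul_mem_powFiltration (ht : t ^ 3 = -1) {c x : Fin 3} (hx : x ≠ c) {n : ℕ} {u : A}
    (hu : u ∈ S.powFiltration c n) : S.X x * u ∈ S.powFiltration c n := by
  induction n generalizing x u with
  | zero => rw [(Submodule.mem_bot k).1 hu, mul_zero]; exact zero_mem _
  | succ n ih =>
    obtain ⟨w, hw, a, ha, rfl⟩ := S.mem_powFiltration_succ.1 hu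
    rw [mul_add]
    refine add_mem (S.powFiltration_mono c n.le_succ (ih hx hw)) ?_
    rcases n with _ | n
    · rw [pow_zero, one_mul, ← one_mul (S.X x * a), ← pow_zero (S.X c)]
      exact S.X_pow_mul_mem_powFiltration 0 (mul_mem (S.X_mem_adjoinNe hx) ha)
    · have ht0 : t ^ 2 ≠ 0 := by
        intro h
        have : t ^ 3 = 0 := by rw [pow_succ, h, zero_mul]
        rw [this] at ht
        exact neg_ne_zero.2 one_ne_zero ht.symm
      set p := -(c + x) with hp
      have hpc : p ≠ c := rack_ne_left c x hx.symm
      have hpx : p ≠ x := rack_ne_right c x hx.symm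
      -- The relation of the pair `(p, x)` has third index `p ◃ x = c`, so it contains `X x * X c`.
      have hr := relation hS ht p x hpx
      rw [show -(p + x) = c from rack_rack_right c x] at hr
      have hm := S.X_pow_mul_mem_powFiltration n ha
      have h : t ^ 2 • (S.X x * (S.X c ^ (n + 1) * a)) =
          t • (S.X c * (S.X p * (S.X c ^ n * a))) - S.X p * (S.X x * (S.X c ^ n * a)) := by
        have := congrArg (· * (S.X c ^ n * a)) hr
        simp only [add_mul, sub_mul, smul_mul_assoc, zero_mul, mul_assoc] at this
        rw [pow_succ' (S.X c), mul_assoc]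
        linear_combination (norm := module) this
      rw [← inv_smul_smul₀ ht0 (S.X x * _), h]
      exact Submodule.smul_mem _ _ (sub_mem
        (Submodule.smul_mem _ _ (S.X_mul_powFiltration_le (ih hpc hm)))
        (S.powFiltration_mono c (Nat.le_succ _) (ih hpc (ih hx hm))))


include hS in
-- The filtration is exhaustive because left multiplication by any generator raises its index by at
-- most one.
theorem mem_adjoinNe_of_e_eq_zero (ht : t ^ 3 = -1) {c : Fin 3} {u : A} (he : S.e c u = 0) :
    u ∈ S.adjoinNe c := by
  have ht0 : t ≠ 0 := by rintro rfl; simp at ht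
  suffices h : ∃ n, u ∈ S.powFiltration c n by
    obtain ⟨n, hn⟩ := h
    exact mem_adjoinNe_of_mem_powFiltration hS ht0 hn he
  clear he
  induction u using S.induction with
  | one =>
    have := S.X_pow_mul_mem_powFiltration 0 (one_mem (S.adjoinNe c))
    rw [pow_zero, one_mul] at this
    exact ⟨1, this⟩
  | smul r u h => exact h.imp fun n h => Submodule.smul_mem _ r h
  | add u w h h' =>
    obtain ⟨n, hn⟩ := h
    obtain ⟨m, hm⟩ := h'
    exact ⟨max n m, add_mem (S.powFiltration_mono c (le_max_left _ _) hn)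
      (S.powFiltration_mono c (le_max_right _ _) hm)⟩
  | X_mul x u h =>
    obtain ⟨n, hn⟩ := h
    by_cases hx : x = c
    · subst hx; exact ⟨n + 1, S.X_mul_powFiltration_le hn⟩
    · exact ⟨n, X_mul_mem_powFiltration hS ht hx hn⟩

/-! ### Subalgebras stable under the left skew derivations -/

/-- Induction on the degree: derivations lower it by one and stay inside `C`, so only the closure
condition `hK` has to be checked. -/
theorem le_of_d_mem {C K : Subalgebra k A} (hd : ∀ y, ∀ u ∈ C, S.d y u ∈ C)
    (hgr : Subalgebra.toSubmodule C ≤ ⨆ n, Subalgebra.toSubmodule C ⊓ S.gens ^ n)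
    (hK : ∀ u ∈ C, (∀ y, S.d y u ∈ K) → u ∈ K) : C ≤ K := by
  have h : ∀ n, ∀ u ∈ C, u ∈ S.gens ^ n → u ∈ K := by
    intro n
    induction n with
    | zero => exact fun u _ hu => gens_pow_zero_mem K hu
    | succ n ih => exact fun u hC hu => hK u hC fun y => ih _ (hd y u hC) (S.d_mem_gens_pow y hu)
  have h' : ⨆ n, Subalgebra.toSubmodule C ⊓ S.gens ^ n ≤ Subalgebra.toSubmodule K :=
    iSup_le fun n w hw => h n w hw.1 hw.2
  exact fun u hu => h' (hgr hu)

include hS in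
-- By induction every `d y u` is a multiple of `X b ^ n`. The operator relation kills those with `y
-- ≠ b`, and then `d b u` determines `u`.
theorem mem_span_X_pow (ht : t ^ 3 = -1) {C : Subalgebra k A}
    (hd : ∀ y, ∀ u ∈ C, S.d y u ∈ C) {b : Fin 3}
    (hb : ∀ x, x ≠ b → ∀ u ∈ C, S.ε (S.d x u) = 0) {n : ℕ} {u : A} (hC : u ∈ C)
    (hu : u ∈ S.gens ^ n) : ∃ r : k, u = r • S.X b ^ n := by
  have ht0 : t ≠ 0 := by rintro rfl; simp at ht
  induction n generalizing u with
  | zero => exact ⟨S.ε u, by rw [pow_zero]; exact S.mem_gens_pow_zero hu⟩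
  | succ n ih =>
    have hε := S.ε_of_mem_gens_pow hu
    have hr : ∀ y, ∃ r : k, S.d y u = r • S.X b ^ n :=
      fun y => ih (hd y u hC) (S.d_mem_gens_pow y hu)
    choose r hr using hr
    have h0 : ∀ a, a ≠ b → S.d a u = 0 := by
      intro a ha
      rcases n with _ | n
      · have := hb a ha u hC
        rw [hr, pow_zero, map_smul, ε_one, smul_eq_mul, mul_one] at this
        rw [hr, this, zero_smul]
      · by_cases hX : qFactorial t (n + 1) = 0
        · rw [hr, X_pow_eq_zero hS b hX, smul_zero]
        -- Only `d b (d a u)` survives here, since `d a` and `d (a ◃ b)` kill powers of `X b`.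
        -- Applying the remaining power of `d b` turns the coefficient into a quantum factorial,
        -- nonzero in this branch.
        · have h := S.d_relation ht a b ha u
          have hab := rack_ne_right a b ha
          simp only [hr, map_smul, d_X_pow, if_pos, if_neg ha.symm, if_neg hab.symm, smul_zero,
            sub_zero, smul_smul] at h
          have h2 : (S.d b ^ n) ((t * (r a * qInt t (n + 1))) • S.X b ^ n) = 0 := by
            rw [← mul_assoc] at h ⊢
            rw [h, map_zero]
          rw [map_smul, d_pow_X_pow, smul_smul, ← Algebra.algebraMap_eq_smul_one] at h2
          have h3 := congrArg S.ε h2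
          rw [Algebra.algebraMap_eq_smul_one, map_smul, ε_one, map_zero, smul_eq_mul, mul_one] at h3
          rw [qFactorial_succ] at hX
          have h4 : r a = 0 := by
            by_contra h4
            have := mul_ne_zero (mul_ne_zero ht0 h4) hX
            exact this (by linear_combination h3)
          rw [hr, h4, zero_smul]
    -- If the quantum integer vanishes, one cannot divide by it; but then `d b ^ (n + 1) = 0` forces
    -- `d b u = 0`, and so `u = 0`.
    by_cases hq : qInt t (n + 1) = 0
    · have h := S.d_pow_eq_zero hq b u
      rw [pow_succ, Module.End.mul_apply, hr, map_smul, d_pow_X_pow, smul_smul] at h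
      have h3 := congrArg S.ε h
      rw [map_smul, ε_one, map_zero, smul_eq_mul, mul_one, mul_eq_zero] at h3
      have hdb : S.d b u = 0 := by
        rw [hr]
        rcases h3 with h3 | h3
        · rw [h3, zero_smul]
        · rw [X_pow_eq_zero hS b h3, smul_zero]
      refine ⟨0, ?_⟩
      rw [zero_smul]
      refine eq_zero_of_d hS hε fun y => ?_
      by_cases hy : y = b
      · rw [hy, hdb]
      · exact h0 y hy
    · refine ⟨r b / qInt t (n + 1), ?_⟩
      rw [← sub_eq_zero]
      refine eq_zero_of_d hS (by rw [map_sub, hε, map_smul, pow_succ', ε_X_mul]; simp) fun y => ?_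
      rw [map_sub, map_smul, d_X_pow]
      by_cases hy : y = b
      · rw [if_pos hy.symm, hy, hr, smul_smul, div_mul_cancel₀ _ hq, sub_self]
      · rw [if_neg (Ne.symm hy), h0 y hy]; simp

theorem forall_or_exists (P : Fin 3 → Prop) :
    (∀ x, P x) ∨ (∃ c, ¬ P c ∧ ∀ x, x ≠ c → P x) ∨ (∃ b, P b ∧ ∀ x, x ≠ b → ¬ P x) ∨
      ∀ x, ¬ P x := by
  classical
  have h : ∀ p : Fin 3 → Bool, (∀ x, p x = true) ∨ (∃ c, ¬ p c = true ∧ ∀ x, x ≠ c → p x = true) ∨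
      (∃ b, p b = true ∧ ∀ x, x ≠ b → ¬ p x = true) ∨ ∀ x, ¬ p x = true := by decide
  simpa using h fun x => decide (P x)

include hS in
/-- If `t ^ 3 = -1`, then graded subalgebras that are stable under the left skew derivations are
generated in degree one. -/
theorem eq_adjoin_of_d_mem (ht : t ^ 3 = -1) {C : Subalgebra k A}
    (hd : ∀ y, ∀ u ∈ C, S.d y u ∈ C) (hX : ∀ x, ∀ u ∈ C, S.ε (S.d x u) • S.X x ∈ C)
    (hgr : Subalgebra.toSubmodule C ≤ ⨆ n, Subalgebra.toSubmodule C ⊓ S.gens ^ n) :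
    C = Algebra.adjoin k ((Subalgebra.toSubmodule C ⊓ S.gens : Submodule k A) : Set A) := by
  refine le_antisymm ?_ (Algebra.adjoin_le fun u hu => hu.1)
  set K := Algebra.adjoin k ((Subalgebra.toSubmodule C ⊓ S.gens : Submodule k A) : Set A) with hK
  have hXK : ∀ x, S.X x ∈ C → S.X x ∈ K :=
    fun x hx => Algebra.subset_adjoin ⟨hx, S.X_mem_gens x⟩
  -- A nonzero coefficient of `X x` in some linear part would put `X x` itself into `C`, by `hX`.
  have hε : ∀ x, S.X x ∉ C → ∀ u ∈ C, S.ε (S.d x u) = 0 := by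
    intro x hx u hu
    by_contra h
    apply hx
    rw [← inv_smul_smul₀ h (S.X x)]
    exact C.smul_mem (hX x u hu) _
  rcases forall_or_exists fun x => S.X x ∈ C with h | ⟨c, hc, h⟩ | ⟨b, hb, h⟩ | h
  · have : K = ⊤ := by
      rw [eq_top_iff, ← S.adjoin_X]
      refine Algebra.adjoin_le ?_
      rintro _ ⟨x, rfl⟩
      exact hXK x (h x)
    rw [this]
    exact le_top
  · refine (le_of_d_mem (K := S.adjoinNe c) hd hgr fun u hu hdu => ?_).trans
      (Algebra.adjoin_le ?_)
    -- To get `e c u = 0`, its augmentation is `ε (d c u) = 0`, and its derivatives are `e c (d y u)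
    -- = 0` because `d y u` is already in the subalgebra.
    · refine mem_adjoinNe_of_e_eq_zero hS ht (eq_zero_of_d hS ?_ fun y => ?_)
      · rw [ε_e, hε c hc u hu]
      · rw [d_e, S.e_adjoinNe (hdu y)]
    · rintro _ ⟨x, hx, rfl⟩
      exact hXK x (h x hx)
  · intro u hu
    refine (iSup_le fun n w hw => ?_ : _ ≤ Subalgebra.toSubmodule K) (hgr hu)
    obtain ⟨r, rfl⟩ := mem_span_X_pow hS ht hd (fun x hx => hε x (h x hx)) hw.1 hw.2
    exact K.smul_mem (pow_mem (hXK b hb) n) r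
  · refine (le_of_d_mem (K := ⊥) hd hgr fun u hu hdu => ?_).trans bot_le
    refine mem_of_d_eq_zero hS _ fun y => ?_
    obtain ⟨r, hr⟩ := Algebra.mem_bot.1 (hdu y)
    have := hε y (h y) u hu
    rw [← hr, Algebra.algebraMap_eq_smul_one, map_smul, ε_one, smul_eq_mul, mul_one] at this
    rw [← hr, this, map_zero]

/-! ### The subalgebra generated by `X b` and the quadratic relator -/

variable (S)

/-- Every derivative of the relator is a multiple of `X b`, so the twisted product rules for the two
generators never leave the subalgebra. -/
theorem d_mem_adjoin_relator {a b : Fin 3} (h : a ≠ b) (y : Fin 3) {u : A}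
    (hu : u ∈ Algebra.adjoin k {S.X b, S.relator a b}) :
    S.d y u ∈ Algebra.adjoin k {S.X b, S.relator a b} := by
  set C := Algebra.adjoin k {S.X b, S.relator a b} with hC
  have hb : S.X b ∈ C := Algebra.subset_adjoin (by simp)
  have hw : S.relator a b ∈ C := Algebra.subset_adjoin (by simp)
  refine (Algebra.adjoin_left_induction (P := fun u => u ∈ C ∧ ∀ y, S.d y u ∈ C)
    ⟨one_mem C, fun y => by rw [d_one]; exact zero_mem C⟩
    (fun r u h => ⟨C.smul_mem h.1 r, fun y => by rw [map_smul]; exact C.smul_mem (h.2 y) r⟩)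
    (fun u w h h' => ⟨add_mem h.1 h'.1, fun y => by rw [map_add]; exact add_mem (h.2 y) (h'.2 y)⟩)
    ?_ hu).2 y
  rintro x (rfl | rfl) u hu
  · refine ⟨mul_mem hb hu.1, fun y => ?_⟩
    rw [d_X_mul]
    refine add_mem ?_ (C.smul_mem (mul_mem hb (hu.2 _)) _)
    split_ifs
    exacts [hu.1, zero_mem C]
  · refine ⟨mul_mem hw hu.1, fun y => ?_⟩
    rw [d_relator_mul S a b y h]
    refine add_mem ?_ (C.smul_mem (mul_mem hw (hu.2 _)) _)
    split_ifs
    exacts [C.smul_mem (mul_mem hb hu.1) _, zero_mem C]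

theorem ε_relator_mul (a b : Fin 3) (u : A) : S.ε (S.relator a b * u) = 0 := by
  simp [relator, add_mul, sub_mul, mul_assoc, ε_X_mul]

theorem ε_d_adjoin_relator {a b : Fin 3} (h : a ≠ b) {y : Fin 3} (hy : y ≠ b) {u : A}
    (hu : u ∈ Algebra.adjoin k {S.X b, S.relator a b}) : S.ε (S.d y u) = 0 := by
  refine Algebra.adjoin_left_induction (P := fun u => S.ε (S.d y u) = 0)
    (by simp [d_one]) (fun r u h => by simp [h]) (fun u w h h' => by simp [h, h']) ?_ hu
  rintro x (rfl | rfl) u _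
  · simp [d_X_mul, if_neg hy.symm, ε_X_mul]
  · rw [d_relator_mul S a b y h]
    split_ifs <;> simp [ε_X_mul, ε_relator_mul]

theorem d_adjoin_X {b y : Fin 3} (hy : y ≠ b) {u : A} (hu : u ∈ Algebra.adjoin k {S.X b}) :
    S.d y u = 0 := by
  refine Algebra.adjoin_left_induction (P := fun u => ∀ y, y ≠ b → S.d y u = 0)
    (fun y _ => S.d_one y) (fun r u h y hy => by rw [map_smul, h y hy, smul_zero])
    (fun u w h h' y hy => by rw [map_add, h y hy, h' y hy, add_zero]) ?_ hu y hy
  rintro x rfl u h y hy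
  rw [d_X_mul, if_neg hy.symm, h _ (rack_ne_left b y hy.symm)]
  simp

/-- If `t ^ 3 ≠ -1`, then the subalgebra generated by `X b` and the quadratic relator is not
generated in degree one. -/
theorem adjoin_relator_ne {a b : Fin 3} (h : a ≠ b) (ht : 1 + t ^ 3 ≠ 0) {C : Subalgebra k A}
    (hC : C = Algebra.adjoin k {S.X b, S.relator a b}) :
    C ≠ Algebra.adjoin k ((Subalgebra.toSubmodule C ⊓ S.gens : Submodule k A) : Set A) := by
  intro heq
  have hw : S.relator a b ∈ C := by rw [hC]; exact Algebra.subset_adjoin (by simp)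
  -- The degree-one part of `C` is contained in the line of `X b`.
  have hle : C ≤ Algebra.adjoin k {S.X b} := by
    rw [heq]
    refine Algebra.adjoin_le fun u hu => ?_
    obtain ⟨huC, hug⟩ := Submodule.mem_inf.1 (SetLike.mem_coe.1 hu)
    rw [Subalgebra.mem_toSubmodule, hC] at huC
    rw [S.eq_sum_of_mem_gens hug, Finset.sum_eq_single b]
    · exact Subalgebra.smul_mem _ (Algebra.subset_adjoin (Set.mem_singleton (S.X b))) _
    · intro y _ hy
      rw [S.ε_d_adjoin_relator h hy huC, zero_smul]
    · simp
  have h1 := S.d_relator_mul a b a h 1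
  rw [mul_one, mul_one, S.d_adjoin_X h (hle hw), d_one, if_pos rfl, mul_zero, smul_zero,
    add_zero] at h1
  -- Applying `d b` and `ε` extracts the coefficient in `0 = (1 + t ^ 3) • X b`.
  have h2 := congrArg (fun u => S.ε (S.d b u)) h1
  simp only [map_zero, map_smul, d_X, if_true, ε_one, smul_eq_mul, mul_one] at h2
  exact ht h2.symm

end BraidedDerivations

/-! ### Skew derivations on the tensor algebra and the Nichols algebra -/

namespace YetterDrinfeld

variable {k G V : Type*} [Field k] [Group G] [AddCommGroup V] [Module k V]

theorem fold_induction {P : TensorAlgebra k V → Prop} (x : TensorAlgebra k V) (one : P 1)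
    (smul : ∀ (r : k) x, P x → P (r • x)) (add : ∀ x y, P x → P y → P (x + y))
    (ι_mul : ∀ v x, P x → P (TensorAlgebra.ι k v * x)) : P x :=
  Algebra.adjoin_left_induction (k := k) (s := Set.range (TensorAlgebra.ι k)) one smul add
    (by rintro _ ⟨v, rfl⟩ x h; exact ι_mul v x h)
    (by rw [TensorAlgebra.adjoin_range_ι]; trivial)

/-- Linear maps on the tensor algebra can be defined by recursion. -/
theorem exists_rec {N : Type*} [AddCommGroup N] [Module k N] (n : N)
    (α : V →ₗ[k] TensorAlgebra k V →ₗ[k] N) (β : V →ₗ[k] Module.End k N) :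
    ∃ F : TensorAlgebra k V →ₗ[k] N, F 1 = n ∧
      ∀ v x, F (TensorAlgebra.ι k v * x) = α v x + β v (F x) := by
  -- The recursion uses `x` as well as `F x`, so `fold` is applied to pairs whose first entry
  -- rebuilds `x`.
  let step : V →ₗ[k] Module.End k (TensorAlgebra k V × N) := LinearMap.mk₂ k
    (fun v p => (TensorAlgebra.ι k v * p.1, α v p.1 + β v p.2))
    (fun v w p => by
      simp only [map_add, add_mul, LinearMap.add_apply, Prod.mk_add_mk]; congr 1; abel)
    (fun r v p => by simp)
    (fun v p q => by simp only [Prod.fst_add, Prod.snd_add, map_add, mul_add, Prod.mk_add_mk]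
                     congr 1; abel)
    (fun r v p => by simp)
  have h1 : ∀ x, (fold step (1, n) x).1 = x := by
    intro x
    induction x using fold_induction with
    | one => rw [fold_one]
    | smul r x h => rw [map_smul, Prod.smul_fst, h]
    | add x y h h' => rw [map_add, Prod.fst_add, h, h']
    | ι_mul v x h => rw [fold_ι_mul]; simp [step, h]
  refine ⟨LinearMap.snd k _ _ ∘ₗ fold step (1, n), by simp [fold_one], fun v x => ?_⟩
  simp only [LinearMap.comp_apply, fold_ι_mul, LinearMap.snd_apply]
  have h := h1 x
  generalize fold step (1, n) x = p at h ⊢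
  subst h
  simp [step]

/-- A basis of a Yetter-Drinfeld module with the braiding of the rack of transpositions of `𝕊₃`
and the constant cocycle `t`. -/
structure TranspositionBasis (D : YetterDrinfeld k G V) (t : k) where
  basis : Module.Basis (Fin 3) k V
  deg : Fin 3 → G
  length : G →* Multiplicative ℤ
  deg_injective : Function.Injective deg
  deg_mul : ∀ x y, deg x * deg y = deg (-(x + y)) * deg x
  length_deg : ∀ x, length (deg x) = Multiplicative.ofAdd 1
  action_basis : ∀ x y, D.action (deg x) (basis y) = t • basis (-(x + y))
  coaction_basis : ∀ x, D.coaction (basis x) = Finsupp.single (deg x) (basis x)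

namespace TranspositionBasis

open BraidedDerivations

variable {D : YetterDrinfeld k G V} {t : k} (b : TranspositionBasis D t)

theorem tensorAction_ι_mul (g : G) (v : V) (x : TensorAlgebra k V) :
    D.tensorAction g (TensorAlgebra.ι k v * x) =
      TensorAlgebra.ι k (D.action g v) * D.tensorAction g x := by
  simp [tensorAction]

theorem tensorAction_one (g : G) : D.tensorAction g 1 = 1 := by
  simp [tensorAction]

/-- The left skew derivation dual to a basis vector. -/
def leftDerivation (y : Fin 3) : TensorAlgebra k V →ₗ[k] TensorAlgebra k V :=
  (TensorProduct.lid k _).toLinearMap ∘ₗ (b.basis.coord y).rTensor _ ∘ₗ D.shuffle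

theorem shuffle_eq_sum (x : TensorAlgebra k V) :
    D.shuffle x = ∑ i, b.basis i ⊗ₜ b.leftDerivation i x := by
  simp only [leftDerivation, LinearMap.comp_apply]
  induction D.shuffle x using TensorProduct.induction_on with
  | zero => simp
  | tmul v y =>
    calc v ⊗ₜ[k] y = (∑ i, b.basis.repr v i • b.basis i) ⊗ₜ[k] y := by rw [b.basis.sum_repr]
      _ = _ := by rw [TensorProduct.sum_tmul]; simp [TensorProduct.smul_tmul']
  | add y z hy hz =>
    conv_lhs => rw [hy, hz]
    simp [TensorProduct.tmul_add, Finset.sum_add_distrib]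

theorem leftDerivation_mul (y x : Fin 3) (u : TensorAlgebra k V) :
    b.leftDerivation y (TensorAlgebra.ι k (b.basis x) * u) = (if x = y then u else 0) +
      t • (TensorAlgebra.ι k (b.basis x) * b.leftDerivation (-(x + y)) u) := by
  conv_lhs => rw [leftDerivation, LinearMap.comp_apply, LinearMap.comp_apply, shuffle_ι_mul,
    b.shuffle_eq_sum]
  simp only [TensorProduct.tmul_sum, map_add, map_sum, braidPast_tmul, b.coaction_basis]
  congr 1
  · simp [Finsupp.single_apply]
  · rw [Finset.sum_eq_single (-(x + y))]
    · rw [Finsupp.sum_single_index (by simp)]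
      simp [action_basis]
    · intro i _ hi
      rw [Finsupp.sum_single_index (by simp)]
      have hi' : -(x + i) ≠ y := fun h => hi ((rack_eq_iff _ _ _).1 h)
      simp only [LinearMap.rTensor_tmul, b.action_basis, map_smul, Module.Basis.coord_apply,
        Module.Basis.repr_self, Finsupp.single_apply, if_neg hi',
        LinearEquiv.coe_coe, TensorProduct.lid_tmul, smul_zero, zero_smul]
    · simp

theorem exists_rightDerivation (y : Fin 3) : ∃ e : TensorAlgebra k V →ₗ[k] TensorAlgebra k V,
    e 1 = 0 ∧ ∀ x u, e (TensorAlgebra.ι k (b.basis x) * u) =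
      TensorAlgebra.ι k (b.basis x) * e u + if x = y then D.tensorAction (b.deg y) u else 0 := by
  obtain ⟨e, h1, h⟩ := exists_rec (0 : TensorAlgebra k V)
    ((b.basis.coord y).smulRight (D.tensorAction (b.deg y)))
    (LinearMap.mul k _ ∘ₗ TensorAlgebra.ι k)
  refine ⟨e, h1, fun x u => ?_⟩
  rw [h, add_comm]
  congr 1
  simp only [LinearMap.smulRight_apply, Module.Basis.coord_apply, Module.Basis.repr_self,
    Finsupp.single_apply]
  split_ifs <;> simp

/-- Freeness of the tensor algebra: `f` reads off the coefficient behind a leading basis vector, so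
a sum `∑ i, X i * u i` vanishes only termwise. -/
theorem exists_dual_mul (y : Fin 3) : ∃ f : TensorAlgebra k V →ₗ[k] TensorAlgebra k V,
    ∀ x u, f (TensorAlgebra.ι k (b.basis x) * u) = if x = y then u else 0 := by
  obtain ⟨f, -, h⟩ := exists_rec (0 : TensorAlgebra k V)
    ((b.basis.coord y).smulRight LinearMap.id) 0
  refine ⟨f, fun x u => ?_⟩
  rw [h]
  simp only [LinearMap.smulRight_apply, Module.Basis.coord_apply, Module.Basis.repr_self,
    Finsupp.single_apply]
  split_ifs <;> simp

theorem span_ι_basis :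
    Submodule.span k (Set.range fun x => TensorAlgebra.ι k (b.basis x)) =
      LinearMap.range (TensorAlgebra.ι k) := by
  rw [Set.range_comp' (TensorAlgebra.ι k) b.basis, Submodule.span_image, b.basis.span_eq,
    LinearMap.range_eq_map]

/-- The left and right skew derivations of the tensor algebra. -/
def tensorDerivations : BraidedDerivations t (TensorAlgebra k V) where
  X x := TensorAlgebra.ι k (b.basis x)
  s x := D.tensorAction (b.deg x)
  d := b.leftDerivation
  e y := (b.exists_rightDerivation y).choose
  ε := TensorAlgebra.algebraMapInv.toLinearMap
  adjoin_X := by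
    rw [← Algebra.adjoin_span, b.span_ι_basis]
    exact TensorAlgebra.adjoin_range_ι
  s_one x := tensorAction_one _
  s_X_mul x y u := by rw [tensorAction_ι_mul, b.action_basis, map_smul, smul_mul_assoc]
  d_one y := by simp [leftDerivation, shuffle_one]
  d_X_mul := b.leftDerivation_mul
  e_one y := (b.exists_rightDerivation y).choose_spec.1
  e_X_mul y := (b.exists_rightDerivation y).choose_spec.2
  ε_one := by simp
  ε_X_mul x u := by simp [TensorAlgebra.algebraMapInv]

theorem tensorDerivations_X (x : Fin 3) :
    b.tensorDerivations.X x = TensorAlgebra.ι k (b.basis x) := rfl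

theorem gens_tensorDerivations :
    b.tensorDerivations.gens = LinearMap.range (TensorAlgebra.ι k) := b.span_ι_basis

theorem symmetrizer_succ (n : ℕ) (u : TensorAlgebra k V) :
    D.symmetrizer (n + 1) u =
      ∑ i, b.tensorDerivations.X i * D.symmetrizer n (b.tensorDerivations.d i u) := by
  simp only [symmetrizer, LinearMap.comp_apply]
  rw [b.shuffle_eq_sum]
  simp [tensorDerivations]

/-- The recursion `symmetrizer_succ` and freeness reduce the vanishing of `S_{n+1} u` to that of
`S_n (d i u)` for all `i`, which is the recursion satisfied by the radical. -/
theorem symmetrizer_eq_zero_iff {n : ℕ} {u : TensorAlgebra k V}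
    (hu : u ∈ b.tensorDerivations.gens ^ n) :
    D.symmetrizer n u = 0 ↔ u ∈ b.tensorDerivations.radical := by
  induction n generalizing u with
  | zero =>
    have h := b.tensorDerivations.mem_gens_pow_zero hu
    change u = 0 ↔ _
    refine ⟨fun h => h ▸ zero_mem _, fun h' => ?_⟩
    rw [h, (b.tensorDerivations.mem_radical_iff.1 h').1, zero_smul]
  | succ n ih =>
    rw [mem_radical_iff, and_iff_right (b.tensorDerivations.ε_of_mem_gens_pow hu)]
    simp only [← fun y => ih (b.tensorDerivations.d_mem_gens_pow y hu)]
    rw [symmetrizer_succ]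
    constructor
    · intro h y
      obtain ⟨f, hf⟩ := b.exists_dual_mul y
      have := congrArg f h
      rw [map_sum, map_zero, Finset.sum_eq_single y] at this
      · rwa [tensorDerivations_X, hf, if_pos rfl] at this
      · intro x _ hx
        rw [tensorDerivations_X, hf, if_neg hx]
      · simp
    · intro h
      simp [h]

theorem ε_dWord_of_mem_gens_pow {A : Type*} [Ring A] [Algebra k A] (S : BraidedDerivations t A)
    {n : ℕ} {l : List (Fin 3)} (h : l.length ≠ n) {u : A} (hu : u ∈ S.gens ^ n) :
    S.ε (S.dWord l u) = 0 := by
  induction n generalizing l u with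
  | zero =>
    rw [S.mem_gens_pow_zero hu]
    cases l with
    | nil => simp at h
    | cons y l => simp [d_one]
  | succ n ih =>
    cases l with
    | nil => exact S.ε_of_mem_gens_pow hu
    | cons y l =>
      have h' : l.length ≠ n := fun e => h (by rw [List.length_cons, e])
      rw [dWord_cons]
      exact ih h' (S.d_mem_gens_pow y hu)

/-- A word of derivations followed by `ε` sees only the component whose degree is the length of the
word. Hence the radical is homogeneous, and it agrees with the kernel of `S_n` in each degree. -/
theorem nicholsIdeal_eq : D.nicholsIdeal = b.tensorDerivations.radicalIdeal := by
  refine le_antisymm (TwoSidedIdeal.span_le.2 ?_) fun u hu => ?_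
  · rintro u ⟨n, hu, h⟩
    rw [← gens_tensorDerivations b] at hu
    exact (mem_radicalIdeal _).2 ((b.symmetrizer_eq_zero_iff hu).1 h)
  · rw [mem_radicalIdeal] at hu
    classical
    let p := DirectSum.decompose
      (fun n => LinearMap.range (TensorAlgebra.ι k : V →ₗ[k] TensorAlgebra k V) ^ n) u
    have hp : ∀ n, (p n : TensorAlgebra k V) ∈ b.tensorDerivations.gens ^ n := by
      intro n; rw [gens_tensorDerivations]; exact (p n).2
    have hsum : ∑ n ∈ p.support, (p n : TensorAlgebra k V) = u :=
      DirectSum.sum_support_decompose _ u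
    have hrad : ∀ n, (p n : TensorAlgebra k V) ∈ b.tensorDerivations.radical := by
      intro n
      rw [mem_radical]
      intro l
      by_cases hl : l.length = n
      · by_cases hn : n ∈ p.support
        · have h := b.tensorDerivations.mem_radical.1 hu l
          rw [← hsum, map_sum, map_sum, Finset.sum_eq_single n] at h
          · exact h
          · intro m _ hm
            exact ε_dWord_of_mem_gens_pow _ (fun e => hm (e.symm.trans hl)) (hp m)
          · exact fun h => absurd hn h
        · rw [DFinsupp.notMem_support_iff.1 hn]; simp
      · exact ε_dWord_of_mem_gens_pow _ hl (hp n)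
    rw [← hsum]
    refine sum_mem fun n _ => TwoSidedIdeal.subset_span ⟨n, (p n).2, ?_⟩
    exact (b.symmetrizer_eq_zero_iff (hp n)).2 (hrad n)

theorem toNichols_eq_zero_iff {u : TensorAlgebra k V} :
    D.toNichols u = 0 ↔ u ∈ b.tensorDerivations.radical := by
  rw [← mem_radicalIdeal, ← nicholsIdeal_eq, ← TwoSidedIdeal.mem_asIdeal]
  exact Ideal.Quotient.eq_zero_iff_mem

theorem toNichols_surjective : Function.Surjective D.toNichols := Ideal.Quotient.mk_surjective

/-! ### Left coideals -/

theorem comul_mul (x : Fin 3) (u : TensorAlgebra k V) :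
    D.comul (b.tensorDerivations.X x * u) = D.comulStep (b.basis x) (D.comul u) :=
  fold_ι_mul _ _ _ _

theorem comulStep_basis (x : Fin 3) (p q : TensorAlgebra k V) :
    D.comulStep (b.basis x) (p ⊗ₜ q) = (b.tensorDerivations.X x * p) ⊗ₜ q +
      b.tensorDerivations.s x p ⊗ₜ (b.tensorDerivations.X x * q) := by
  rw [comulStep_tmul, b.coaction_basis, Finsupp.sum_single_index (by simp)]
  rfl

theorem rTensor_d_comulStep (y x : Fin 3) (z : TensorAlgebra k V ⊗[k] TensorAlgebra k V) :
    (b.tensorDerivations.d y).rTensor _ (D.comulStep (b.basis x) z) = (if x = y then z else 0) +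
      t • D.comulStep (b.basis x) ((b.tensorDerivations.d (-(x + y))).rTensor _ z) := by
  induction z using TensorProduct.induction_on with
  | zero => simp
  | tmul p q =>
    rw [comulStep_basis, map_add, LinearMap.rTensor_tmul, LinearMap.rTensor_tmul,
      LinearMap.rTensor_tmul, comulStep_basis, d_X_mul, d_s, TensorProduct.add_tmul, smul_add,
      TensorProduct.smul_tmul', TensorProduct.smul_tmul', add_assoc]
    congr 1
    split_ifs <;> simp
  | add z w hz hw =>
    simp only [map_add, hz, hw, smul_add]
    split_ifs <;> abel

/-- Coassociativity for the generator split off at the left: `d y` on the left tensor factor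
commutes with `Δ`. With the counit law this recovers each iterated derivative of `u` from `Δ u`. -/
theorem rTensor_d_comul (y : Fin 3) (u : TensorAlgebra k V) :
    (b.tensorDerivations.d y).rTensor _ (D.comul u) = D.comul (b.tensorDerivations.d y u) := by
  induction u using b.tensorDerivations.induction generalizing y with
  | one => rw [d_one, comul, fold_one, LinearMap.rTensor_tmul, d_one]; simp
  | smul r u h => simp only [map_smul, h]
  | add u w h h' => simp only [map_add, h, h']
  | X_mul x u h =>
    rw [comul_mul, rTensor_d_comulStep, h, d_X_mul, map_add, map_smul, comul_mul]
    split_ifs <;> simp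

theorem rTensor_dWord_comul (l : List (Fin 3)) (u : TensorAlgebra k V) :
    (b.tensorDerivations.dWord l).rTensor _ (D.comul u) =
      D.comul (b.tensorDerivations.dWord l u) := by
  induction l generalizing u with
  | nil => exact LinearMap.rTensor_id_apply _ _ _
  | cons y l ih =>
    rw [dWord_cons, ← ih, ← rTensor_d_comul]
    exact LinearMap.rTensor_comp_apply _ _ _ _

theorem lid_ε_comul (u : TensorAlgebra k V) :
    TensorProduct.lid k _ (b.tensorDerivations.ε.rTensor _ (D.comul u)) = u := by
  induction u using b.tensorDerivations.induction with
  | one => rw [comul, fold_one, LinearMap.rTensor_tmul, ε_one]; simp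
  | smul r u h => simp only [map_smul, h]
  | add u w h h' => simp only [map_add, h, h']
  | X_mul x u h =>
    rw [comul_mul]
    conv_rhs => rw [← h]
    generalize D.comul u = z
    induction z using TensorProduct.induction_on with
    | zero => simp
    | tmul p q =>
      rw [comulStep_basis, map_add, LinearMap.rTensor_tmul, LinearMap.rTensor_tmul, ε_X_mul, ε_s,
        LinearMap.rTensor_tmul]
      simp
    | add z w hz hw => simp only [map_add, hz, hw, mul_add]


theorem exists_nicholsDerivations : ∃ R : BraidedDerivations t D.Nichols,
    (∀ x, R.X x = D.ι (b.basis x)) ∧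
    (∀ y u, R.d y (D.toNichols u) = D.toNichols (b.tensorDerivations.d y u)) ∧
    (∀ u, R.ε (D.toNichols u) = b.tensorDerivations.ε u) ∧ R.radical = ⊥ :=
  b.tensorDerivations.exists_quotient D.toNichols toNichols_surjective
    fun _ => b.toNichols_eq_zero_iff

/-- The structure of skew derivations on the Nichols algebra. -/
def nicholsDerivations : BraidedDerivations t D.Nichols := b.exists_nicholsDerivations.choose

theorem nicholsDerivations_X (x : Fin 3) : b.nicholsDerivations.X x = D.ι (b.basis x) :=
  b.exists_nicholsDerivations.choose_spec.1 x

theorem nicholsDerivations_d (y : Fin 3) (u : TensorAlgebra k V) :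
    b.nicholsDerivations.d y (D.toNichols u) = D.toNichols (b.tensorDerivations.d y u) :=
  b.exists_nicholsDerivations.choose_spec.2.1 y u

theorem nicholsDerivations_ε (u : TensorAlgebra k V) :
    b.nicholsDerivations.ε (D.toNichols u) = b.tensorDerivations.ε u :=
  b.exists_nicholsDerivations.choose_spec.2.2.1 u

theorem radical_nicholsDerivations : b.nicholsDerivations.radical = ⊥ :=
  b.exists_nicholsDerivations.choose_spec.2.2.2

theorem nicholsDerivations_dWord (l : List (Fin 3)) (u : TensorAlgebra k V) :
    b.nicholsDerivations.dWord l (D.toNichols u) = D.toNichols (b.tensorDerivations.dWord l u) := by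
  induction l generalizing u with
  | nil => rfl
  | cons y l ih => rw [dWord_cons, dWord_cons, nicholsDerivations_d, ih]

/-- Evaluation of a word of skew derivations on the left tensor factor. -/
def evalLeft (Q : Type*) [AddCommGroup Q] [Module k Q] (l : List (Fin 3)) :
    D.Nichols ⊗[k] Q →ₗ[k] Q :=
  (TensorProduct.lid k Q).toLinearMap ∘ₗ
    (b.nicholsDerivations.ε ∘ₗ b.nicholsDerivations.dWord l).rTensor Q

theorem evalLeft_tmul {Q : Type*} [AddCommGroup Q] [Module k Q] (l : List (Fin 3))
    (u : D.Nichols) (q : Q) : b.evalLeft Q l (u ⊗ₜ q) =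
      b.nicholsDerivations.ε (b.nicholsDerivations.dWord l u) • q := by
  simp [evalLeft]

theorem evalLeft_comul (l : List (Fin 3)) (u : TensorAlgebra k V) :
    b.evalLeft D.Nichols l
      (TensorProduct.map D.toNichols.toLinearMap D.toNichols.toLinearMap (D.comul u)) =
      D.toNichols (b.tensorDerivations.dWord l u) := by
  conv_rhs => rw [← b.lid_ε_comul (b.tensorDerivations.dWord l u), ← rTensor_dWord_comul]
  generalize D.comul u = z
  induction z using TensorProduct.induction_on with
  | zero => simp
  | tmul p q =>
    rw [TensorProduct.map_tmul, evalLeft_tmul, AlgHom.toLinearMap_apply, nicholsDerivations_dWord,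
      nicholsDerivations_ε]
    simp
  | add z w hz hw => simp only [map_add, hz, hw]

/-- Expanding `z` in a basis of `Q`, each coefficient lies in the radical of the Nichols algebra,
which is zero. -/
theorem eq_zero_of_evalLeft {Q : Type*} [AddCommGroup Q] [Module k Q] {z : D.Nichols ⊗[k] Q}
    (hz : ∀ l, b.evalLeft Q l z = 0) : z = 0 := by
  obtain ⟨c, rfl⟩ := TensorProduct.eq_repr_basis_right (Module.Basis.ofVectorSpace k Q) z
  suffices h : c = 0 by rw [h]; simp
  ext i
  rw [Finsupp.zero_apply, ← Submodule.mem_bot k, ← b.radical_nicholsDerivations, mem_radical]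
  intro l
  have h := hz l
  simp only [Finsupp.sum, map_sum, evalLeft_tmul] at h
  by_cases hi : i ∈ c.support
  · exact linearIndependent_iff'.1 (Module.Basis.ofVectorSpace k Q).linearIndependent _ _ h i hi
  · rw [Finsupp.notMem_support_iff.1 hi, map_zero, map_zero]

theorem dWord_mem {C : Submodule k D.Nichols}
    (hC : ∀ y, ∀ u ∈ C, b.nicholsDerivations.d y u ∈ C) (l : List (Fin 3)) {u : D.Nichols}
    (hu : u ∈ C) : b.nicholsDerivations.dWord l u ∈ C := by
  induction l generalizing u with
  | nil => exact hu
  | cons y l ih => exact ih (hC y u hu)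

/-- Left coideals are the subspaces stable under the left skew derivations. -/
theorem isLeftCoideal_iff {C : Submodule k D.Nichols} :
    D.IsLeftCoideal C ↔ ∀ y, ∀ u ∈ C, b.nicholsDerivations.d y u ∈ C := by
  constructor
  · intro h y u hu
    obtain ⟨u, rfl⟩ := toNichols_surjective u
    obtain ⟨z, hz⟩ := h u hu
    have h1 := b.evalLeft_comul [y] u
    rw [dWord_cons, dWord_nil, ← nicholsDerivations_d, ← hz] at h1
    rw [← h1]
    clear hz h1
    induction z using TensorProduct.induction_on with
    | zero => simp
    | tmul p q =>
      rw [LinearMap.lTensor_tmul, evalLeft_tmul]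
      exact C.smul_mem _ q.2
    | add z w hz hw => rw [map_add, map_add]; exact add_mem hz hw
  · intro h u hu
    -- Membership in `B(V) ⊗ C` means vanishing in `B(V) ⊗ (B(V) / C)`, where `evalLeft` separates
    -- elements; the evaluations of `Δ u` are the iterated derivatives of `u`, taken modulo `C`.
    have hex := lTensor_exact D.Nichols
      (LinearMap.exact_subtype_mkQ C) C.mkQ_surjective
    refine (hex _).1 (b.eq_zero_of_evalLeft fun l => ?_)
    have h1 : ∀ z : D.Nichols ⊗[k] D.Nichols,
        b.evalLeft _ l (C.mkQ.lTensor D.Nichols z) = C.mkQ (b.evalLeft _ l z) := by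
      intro z
      induction z using TensorProduct.induction_on with
      | zero => simp
      | tmul p q => rw [LinearMap.lTensor_tmul, evalLeft_tmul, evalLeft_tmul, map_smul]
      | add z w hz hw => simp only [map_add, hz, hw]
    rw [h1, evalLeft_comul, ← nicholsDerivations_dWord, Submodule.mkQ_apply,
      Submodule.Quotient.mk_eq_zero]
    exact b.dWord_mem h l hu

/-! ### Gradings -/

theorem gens_nicholsDerivations : b.nicholsDerivations.gens = LinearMap.range D.ι := by
  rw [gens, show b.nicholsDerivations.X = fun x => D.ι (b.basis x) from
    funext b.nicholsDerivations_X, Set.range_comp' D.ι b.basis, Submodule.span_image,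
    b.basis.span_eq, LinearMap.range_eq_map]

theorem nicholsDegree_eq (n : ℕ) : D.nicholsDegree n = b.nicholsDerivations.gens ^ n := by
  rw [nicholsDegree, gens_nicholsDerivations]

theorem deg_eq_of_mem_component {g : G} {w : V} (hw : w ∈ D.component g) {i : Fin 3}
    (hi : b.basis.repr w i ≠ 0) : b.deg i = g := by
  by_contra hg
  apply hi
  have h1 : D.coaction w = Finsupp.single g w := hw
  rw [← b.basis.sum_repr w, map_sum] at h1
  have h2 := DFunLike.congr_fun h1 (b.deg i)
  rw [Finsupp.single_eq_of_ne hg, Finsupp.finsetSum_apply, Finset.sum_eq_single i] at h2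
  · rw [map_smul, b.coaction_basis, Finsupp.smul_apply, Finsupp.single_eq_same] at h2
    exact (smul_eq_zero.1 h2).resolve_right (b.basis.ne_zero i)
  · intro j _ hj
    rw [map_smul, b.coaction_basis, Finsupp.smul_apply,
      Finsupp.single_eq_of_ne (fun e => hj (b.deg_injective e).symm), smul_zero]
  · simp

theorem length_of_mem_component {g : G} {w : V} (hw : w ∈ D.component g) (h0 : w ≠ 0) :
    b.length g = Multiplicative.ofAdd 1 := by
  have : ∃ i, b.basis.repr w i ≠ 0 := by
    by_contra h
    push Not at h
    apply h0
    rw [← b.basis.sum_repr w]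
    simp [h]
  obtain ⟨i, hi⟩ := this
  rw [← b.deg_eq_of_mem_component hw hi, length_deg]

theorem length_prod {l : List (G × V)} (hl : ∀ p ∈ l, p.2 ∈ D.component p.1)
    (h0 : ∀ p ∈ l, p.2 ≠ 0) :
    b.length (l.map Prod.fst).prod = Multiplicative.ofAdd (l.length : ℤ) := by
  induction l with
  | nil => simp
  | cons p l ih =>
    rw [List.map_cons, List.prod_cons, map_mul,
      b.length_of_mem_component (hl p (by simp)) (h0 p (by simp)),
      ih (fun q hq => hl q (by simp [hq])) (fun q hq => h0 q (by simp [hq])), ← ofAdd_add]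
    simp [add_comm]

theorem ε_d_ι (x : Fin 3) (w : V) :
    b.nicholsDerivations.ε (b.nicholsDerivations.d x (D.ι w)) = b.basis.repr w x := by
  conv_lhs => rw [← b.basis.sum_repr w]
  simp only [map_sum, map_smul, ← nicholsDerivations_X, d_X]
  rw [Finset.sum_eq_single x]
  · simp [ε_one]
  · intro y _ hy; simp [hy]
  · simp

theorem prod_mem_gens_pow (l : List (G × V)) :
    (l.map fun p => D.ι p.2).prod ∈ b.nicholsDerivations.gens ^ l.length := by
  induction l with
  | nil => simp [Submodule.one_le.1 le_rfl]
  | cons p l ih =>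
    rw [List.map_cons, List.prod_cons, List.length_cons, pow_succ']
    refine Submodule.mul_mem_mul ?_ ih
    rw [gens_nicholsDerivations]
    exact ⟨p.2, rfl⟩

/-- The projection of a homogeneous element to the span of a generator. -/
theorem linearPart_of_mem_component {g : G} {u : D.Nichols} (hu : u ∈ D.nicholsComponent g)
    (x : Fin 3) :
    b.nicholsDerivations.ε (b.nicholsDerivations.d x u) • b.nicholsDerivations.X x =
      (open Classical in if g = b.deg x then u else 0) := by
  classical
  induction hu using Submodule.span_induction with
  | zero => simp
  | add u w _ _ hu hw => rw [map_add, map_add, add_smul, hu, hw]; split_ifs <;> simp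
  | smul r u _ hu => rw [map_smul, map_smul, smul_assoc, hu]; split_ifs <;> simp
  | mem u hu =>
    obtain ⟨l, hl, rfl, rfl⟩ := hu
    -- The zero vector is homogeneous of every degree, so products with a zero factor carry no
    -- information about the length.
    by_cases h0 : ∃ p ∈ l, p.2 = 0
    · obtain ⟨p, hp, h0⟩ := h0
      have : (l.map fun p => D.ι p.2).prod = 0 :=
        List.prod_eq_zero (List.mem_map.2 ⟨p, hp, by rw [h0, map_zero]⟩)
      rw [this]; simp
    · push Not at h0
      have hlen := b.length_prod hl h0
      have hmem := b.prod_mem_gens_pow l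
      -- The length homomorphism recovers the `ℕ`-degree from the `G`-degree, so only products of
      -- one factor can have degree `deg x`.
      have hne : l.length ≠ 1 → (l.map Prod.fst).prod ≠ b.deg x := by
        intro h e
        rw [e, length_deg] at hlen
        exact h (by exact_mod_cast (Multiplicative.ofAdd.injective hlen).symm)
      rcases l with _ | ⟨p, _ | ⟨q, l⟩⟩
      · rw [if_neg (hne (by simp))]; simp [d_one]
      · simp only [List.map_cons, List.map_nil, List.prod_cons, List.prod_nil, mul_one]
        have hp := hl p (by simp)
        rw [ε_d_ι]
        split_ifs with hx
        · rw [nicholsDerivations_X, ← map_smul]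
          congr 1
          conv_rhs => rw [← b.basis.sum_repr p.2]
          rw [Finset.sum_eq_single x]
          · intro y _ hy
            by_contra h
            refine hy (b.deg_injective ?_)
            rw [b.deg_eq_of_mem_component hp (fun e => h (by rw [e, zero_smul])), hx]
          · simp
        · by_cases h : b.basis.repr p.2 x = 0
          · rw [h, zero_smul]
          · exact absurd (b.deg_eq_of_mem_component hp h).symm hx
      · rw [if_neg (hne (by simp))]
        have := b.nicholsDerivations.d_mem_gens_pow x hmem
        rw [b.nicholsDerivations.ε_of_mem_gens_pow this, zero_smul]

theorem linearPart_mem {C : Subalgebra k D.Nichols}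
    (hC : Subalgebra.toSubmodule C ≤ ⨆ g, Subalgebra.toSubmodule C ⊓ D.nicholsComponent g)
    (x : Fin 3) {u : D.Nichols} (hu : u ∈ C) :
    b.nicholsDerivations.ε (b.nicholsDerivations.d x u) • b.nicholsDerivations.X x ∈ C := by
  have h := hC hu
  clear hu
  induction h using Submodule.iSup_induction' with
  | mem g u h =>
    rw [b.linearPart_of_mem_component h.2]
    split_ifs
    exacts [h.1, zero_mem C]
  | zero => simp
  | add u w _ _ h h' => rw [map_add, map_add, add_smul]; exact add_mem h h'

theorem one_mem_nicholsComponent : (1 : D.Nichols) ∈ D.nicholsComponent 1 :=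
  Submodule.subset_span ⟨[], by simp⟩

theorem mul_mem_nicholsComponent {g h : G} {u w : D.Nichols} (hu : u ∈ D.nicholsComponent g)
    (hw : w ∈ D.nicholsComponent h) : u * w ∈ D.nicholsComponent (g * h) := by
  refine Submodule.span_induction₂ (p := fun u w _ _ => u * w ∈ D.nicholsComponent (g * h))
    ?_ ?_ ?_ ?_ ?_ ?_ ?_ hu hw
  · rintro _ _ ⟨l, hl, rfl, rfl⟩ ⟨m, hm, rfl, rfl⟩
    refine Submodule.subset_span ⟨l ++ m, ?_, by simp, by simp⟩
    intro p hp
    rcases List.mem_append.1 hp with hp | hp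
    exacts [hl p hp, hm p hp]
  · intro w _; rw [zero_mul]; exact zero_mem _
  · intro w _; rw [mul_zero]; exact zero_mem _
  · intro u v w _ _ _ h h'; rw [add_mul]; exact add_mem h h'
  · intro u v w _ _ _ h h'; rw [mul_add]; exact add_mem h h'
  · intro r u w _ _ h; rw [smul_mul_assoc]; exact Submodule.smul_mem _ r h
  · intro r u w _ _ h; rw [mul_smul_comm]; exact Submodule.smul_mem _ r h

theorem X_mem_nicholsComponent (x : Fin 3) :
    b.nicholsDerivations.X x ∈ D.nicholsComponent (b.deg x) := by
  rw [nicholsDerivations_X]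
  exact Submodule.subset_span ⟨[(b.deg x, b.basis x)], fun p hp => by
    rw [List.mem_singleton.1 hp]; exact b.coaction_basis x,
    by simp, by simp⟩

/-! ### Left coideal subalgebras -/

theorem generatedInDegreeOne (b : TranspositionBasis D t) (ht : t ^ 3 = -1)
    {C : Subalgebra k D.Nichols}
    (hC : D.IsLeftCoidealSubalgebra C) : D.GeneratedInDegreeOne C := by
  have hgr := hC.graded
  simp only [b.nicholsDegree_eq] at hgr
  rw [GeneratedInDegreeOne, b.nicholsDegree_eq, pow_one]
  exact eq_adjoin_of_d_mem b.radical_nicholsDerivations ht (b.isLeftCoideal_iff.1 hC.leftCoideal)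
    (fun x u hu => b.linearPart_mem hC.subcomodule x hu) hgr

theorem isLeftCoidealSubalgebra_adjoin_relator {x y : Fin 3} (h : x ≠ y) :
    D.IsLeftCoidealSubalgebra (Algebra.adjoin k
      {b.nicholsDerivations.X y, b.nicholsDerivations.relator x y}) where
  leftCoideal := b.isLeftCoideal_iff.2 fun z _ hu =>
    b.nicholsDerivations.d_mem_adjoin_relator h z hu
  graded := by
    simp only [b.nicholsDegree_eq]
    refine (Algebra.adjoin_le_iSup_inf
      (fun n : Multiplicative ℕ => b.nicholsDerivations.gens ^ n.toAdd) ?_ ?_ ?_).trans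
      (iSup_le fun n => le_iSup_of_le n.toAdd le_rfl)
    · simp [Submodule.one_le.1 le_rfl]
    · intro i j u hu w hw
      rw [toAdd_mul, pow_add]
      exact Submodule.mul_mem_mul hu hw
    · have hX := b.nicholsDerivations.X_mem_gens
      rintro _ (rfl | rfl)
      · exact ⟨Multiplicative.ofAdd 1, by simpa using hX y⟩
      · refine ⟨Multiplicative.ofAdd 2, ?_⟩
        rw [toAdd_ofAdd, pow_two]
        exact add_mem (sub_mem (Submodule.mul_mem_mul (hX _) (hX _))
          (Submodule.smul_mem _ _ (Submodule.mul_mem_mul (hX _) (hX _))))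
          (Submodule.smul_mem _ _ (Submodule.mul_mem_mul (hX _) (hX _)))
  subcomodule := by
    refine Algebra.adjoin_le_iSup_inf D.nicholsComponent one_mem_nicholsComponent
      (fun i j u hu w hw => mul_mem_nicholsComponent hu hw) ?_
    have hX := b.X_mem_nicholsComponent
    rintro _ (rfl | rfl)
    · exact ⟨_, hX y⟩
    · refine ⟨b.deg x * b.deg y, ?_⟩
      -- All three monomials have the same `G`-degree, since `deg x * deg y = deg (x ◃ y) * deg x =
      -- deg y * deg (x ◃ y)`.
      refine add_mem (sub_mem (mul_mem_nicholsComponent (hX x) (hX y)) (Submodule.smul_mem _ _ ?_))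
        (Submodule.smul_mem _ _ ?_)
      · rw [b.deg_mul]
        exact mul_mem_nicholsComponent (hX _) (hX x)
      · have h1 := b.deg_mul y (-(x + y))
        rw [add_comm x y, rack_rack, add_comm y x] at h1
        rw [← h1]
        exact mul_mem_nicholsComponent (hX y) (hX _)

/-- If `t ^ 3 ≠ -1`, then a generator and the quadratic relator generate a left coideal subalgebra
that is not generated in degree one. -/
theorem isLeftCoidealSubalgebra_and_not_generatedInDegreeOne {x y z : Fin 3} (h : x ≠ y)
    (hz : z = -(x + y)) (ht : 1 + t ^ 3 ≠ 0) {C : Subalgebra k D.Nichols}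
    (hC : C = Algebra.adjoin k {D.ι (b.basis y), D.ι (b.basis x) * D.ι (b.basis y) -
      t • (D.ι (b.basis z) * D.ι (b.basis x)) + t ^ 2 • (D.ι (b.basis y) * D.ι (b.basis z))}) :
    D.IsLeftCoidealSubalgebra C ∧ ¬ D.GeneratedInDegreeOne C := by
  have hC' : C = Algebra.adjoin k
      {b.nicholsDerivations.X y, b.nicholsDerivations.relator x y} := by
    rw [hC, hz]
    simp only [relator, nicholsDerivations_X]
  refine ⟨hC' ▸ b.isLeftCoidealSubalgebra_adjoin_relator h, ?_⟩
  rw [GeneratedInDegreeOne, b.nicholsDegree_eq, pow_one]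
  exact b.nicholsDerivations.adjoin_relator_ne h ht hC'

end TranspositionBasis
end YetterDrinfeld

/-! ### The module `M(g₁₂, ρ_t)` and its basis -/

namespace YetterDrinfeld

theorem Ind.mk_mul_centralizer {k G A : Type*} [Field k] [Group G] [AddCommGroup A] [Module k A]
    (g : G) (ρ : Representation k (Subgroup.centralizer {g}) A) (h : G)
    (z : Subgroup.centralizer {g}) (a : A) :
    Ind.mk g ρ (h * z) a = Ind.mk g ρ h (ρ z a) := by
  have h1 := Representation.Coinvariants.mk_self_apply
    (Representation.tprod ((Representation.leftRegular k G).comp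
      (Subgroup.centralizer {g}).subtype) ρ) z (MonoidAlgebra.single (h * z)⁻¹ 1 ⊗ₜ a)
  simpa [Ind.mk] using h1.symm

/-- A transposition basis may be rescaled. -/
def TranspositionBasis.smul {k G V : Type*} [Field k] [Group G] [AddCommGroup V] [Module k V]
    {D : YetterDrinfeld k G V} {t : k} (b : TranspositionBasis D t) (r : kˣ) :
    TranspositionBasis D t where
  __ := b
  basis := b.basis.unitsSMul fun _ => r
  action_basis x y := by
    simp only [Module.Basis.unitsSMul_apply, Units.smul_def, map_smul, b.action_basis]
    rw [smul_comm]
  coaction_basis x := by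
    simp only [Module.Basis.unitsSMul_apply, Units.smul_def, map_smul, b.coaction_basis,
      Finsupp.smul_single]

end YetterDrinfeld

namespace TranspositionRack

open YetterDrinfeld
open scoped Quandles

theorem env_induction {n : ℕ} {P : Env n → Prop} (h : Env n) (one : P 1)
    (mul : ∀ a b, P a → P b → P (a * b)) (inv : ∀ a, P a → P a⁻¹)
    (of : ∀ σ, P (Rack.toEnvelGroup (TranspositionRack n) σ)) : P h := by
  refine Quotient.inductionOn h fun a => ?_
  induction a with
  | unit => exact one
  | incl σ => exact of σ
  | mul a b ha hb => exact mul _ _ ha hb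
  | inv a ha => exact inv _ ha

/-- The transposition in `𝕊₃` that fixes `i`. -/
def fixing (i : Fin 3) : TranspositionRack 3 :=
  swap (i + 1) (i + 2) (by revert i; decide)

theorem exists_eq_fixing (σ : TranspositionRack 3) : ∃ i, σ = fixing i := by
  obtain ⟨σ, x, y, h, rfl⟩ := σ
  have : ∀ x y : Fin 3, x ≠ y → ∃ i : Fin 3, Equiv.swap x y = Equiv.swap (i + 1) (i + 2) := by
    decide
  obtain ⟨i, hi⟩ := this x y h
  exact ⟨i, Subtype.ext hi⟩

theorem fixing_apply (x y : Fin 3) : (fixing x).1 y = -(x + y) := by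
  revert x y; decide

/-- The generator of the enveloping group of the transposition that fixes `i`. -/
def genFixing (i : Fin 3) : Env 3 := Rack.toEnvelGroup (TranspositionRack 3) (fixing i)

theorem genFixing_two : genFixing 2 = g12 := rfl

theorem genFixing_zero : genFixing 0 = g23 := rfl

theorem genFixing_one : genFixing 1 = g13 :=
  congrArg (Rack.toEnvelGroup (TranspositionRack 3)) (Subtype.ext (Equiv.swap_comm _ _))

/-- The homomorphism from the enveloping group to the symmetric group. -/
def perm : Env 3 →* Equiv.Perm (Fin 3) :=
  Rack.toEnvelGroup.map { toFun := fun σ => σ.1, map_act' := rfl }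

/-- The homomorphism from the enveloping group to `ℤ` with value `1` on all generators. -/
def lengthHom : Env 3 →* Multiplicative ℤ :=
  Rack.toEnvelGroup.map { toFun := fun _ => Multiplicative.ofAdd 1, map_act' := by simp }

theorem perm_genFixing (x y : Fin 3) : perm (genFixing x) y = -(x + y) := fixing_apply x y

theorem genFixing_injective : Function.Injective genFixing := by
  intro x y h
  have h1 := perm_genFixing x x
  rw [h, perm_genFixing] at h1
  exact (add_right_cancel (neg_injective h1)).symm

/-- The permutation of `h` moves the fixed point of a transposition to that of its conjugate; for a
generator `h` this is the defining relation of the enveloping group. -/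
theorem conj_genFixing (h : Env 3) (i : Fin 3) :
    h * genFixing i * h⁻¹ = genFixing (perm h i) := by
  induction h using env_induction generalizing i with
  | one => simp
  | mul a b ha hb =>
    rw [map_mul, Equiv.Perm.mul_apply, ← ha, ← hb, mul_inv_rev]
    group
  | inv a ha =>
    have := ha (perm a⁻¹ i)
    rw [← Equiv.Perm.mul_apply, ← map_mul, mul_inv_cancel, map_one, Equiv.Perm.one_apply] at this
    rw [← this]; group
  | of σ =>
    obtain ⟨x, rfl⟩ := exists_eq_fixing σ
    have h1 : fixing x ◃ fixing i = fixing (-(x + i)) := by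
      revert x i; exact fun x i => Subtype.ext (by revert x i; decide)
    have h2 := (Rack.toEnvelGroup (TranspositionRack 3)).map_act (x := fixing x) (y := fixing i)
    rw [h1] at h2
    have h3 : perm (Rack.toEnvelGroup (TranspositionRack 3) (fixing x)) i = -(x + i) :=
      perm_genFixing x i
    rw [h3]
    exact h2.symm

/-- Identifies the cosets of the centralizer with the three points, so the induced module has
dimension three. -/
theorem mem_centralizer_iff (z : Env 3) : z ∈ Subgroup.centralizer {g12} ↔ perm z 2 = 2 := by
  rw [Subgroup.mem_centralizer_singleton_iff, ← genFixing_two,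
    ← genFixing_injective.eq_iff (a := perm z 2), ← conj_genFixing, mul_inv_eq_iff_eq_mul]

section

variable {k : Type*} [Field k] (t : kˣ)

/-- The coordinates of `M(g₁₂, ρ_t)`. -/
def coords : Ind g12 (rho t) →ₗ[k] (Fin 3 → k) :=
  Representation.Coinvariants.lift _
    (TensorProduct.lift
      (Finsupp.lsum k (fun h : Env 3 => LinearMap.toSpanSingleton k (k →ₗ[k] (Fin 3 → k))
        ((charConst 3 t h⁻¹ : k) • LinearMap.single k (fun _ => k) (perm h⁻¹ 2))) ∘ₗ
        (MonoidAlgebra.coeffLinearEquiv k).toLinearMap))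
    (fun z => by
      ext h i
      have hz : (perm z)⁻¹ 2 = 2 := by
        rw [Equiv.Perm.inv_eq_iff_eq]; exact ((mem_centralizer_iff z).1 z.2).symm
      have h1 : Equiv.symm (perm z * perm h) 2 = Equiv.symm (perm h) 2 :=
        congrArg (perm h).symm hz
      have h2 : rho t z 1 = (charConst 3 t z : k) * 1 := rfl
      simp [h1, h2, Pi.single_apply])

theorem coords_mk (h : Env 3) (a : k) : coords t (Ind.mk g12 (rho t) h a) =
    Pi.single (perm h 2) ((charConst 3 t h : k) * a) := by
  have h1 : Equiv.symm (perm h)⁻¹ = perm h := inv_inv (perm h)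
  simp [coords, h1, ← Pi.single_smul]

/-- A representative of the coset of the centralizer of `g₁₂` that maps `2` to `i`. -/
def coset (i : Fin 3) : Env 3 := if i = 2 then 1 else if i = 1 then genFixing 0 else genFixing 1

theorem perm_coset (i : Fin 3) : perm (coset i) 2 = i := by
  fin_cases i <;> simp [coset, perm_genFixing]
  rfl

/-- The basis vector of `M(g₁₂, ρ_t)` of degree `genFixing i`. -/
def basisVector (i : Fin 3) : Ind g12 (rho t) :=
  Ind.mk g12 (rho t) (coset i) ((charConst 3 t (coset i) : k)⁻¹)

/-- Since `rho t` is the restriction of a character of the whole group, the induced module is that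
character tensored with the permutation module. Normalizing the basis vectors by the character gives
the constant cocycle `t`. -/
theorem mk_eq (h : Env 3) (a : k) : Ind.mk g12 (rho t) h a =
    ((charConst 3 t h : k) * a) • basisVector t (perm h 2) := by
  have hz : (coset (perm h 2))⁻¹ * h ∈ Subgroup.centralizer {g12} := by
    rw [mem_centralizer_iff, map_mul, map_inv, Equiv.Perm.mul_apply, Equiv.Perm.inv_eq_iff_eq,
      perm_coset]
  have h1 := Ind.mk_mul_centralizer g12 (rho t) (coset (perm h 2)) ⟨_, hz⟩ a
  rw [mul_inv_cancel_left] at h1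
  rw [h1, basisVector, ← map_smul]
  congr 1
  simp [rho]
  ring

theorem coords_basisVector (i : Fin 3) : coords t (basisVector t i) = Pi.single i 1 := by
  rw [basisVector, coords_mk, perm_coset]
  simp

/-- The standard basis of `M(g₁₂, ρ_t)`. -/
def transpositionBasis : TranspositionBasis (M t) (t : k) where
  basis := Module.Basis.mk (v := basisVector t)
    (by
      refine LinearIndependent.of_comp (coords t) ?_
      have : coords t ∘ basisVector t = Pi.basisFun k (Fin 3) := by
        funext i; simp [coords_basisVector]
      rw [this]
      exact (Pi.basisFun k (Fin 3)).linearIndependent)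
    (by
      intro x _
      induction x using Ind.induction with
      | mk h a =>
        rw [mk_eq]
        exact Submodule.smul_mem _ _ (Submodule.subset_span ⟨_, rfl⟩)
      | zero => exact zero_mem _
      | add x y hx hy => exact add_mem (hx trivial) (hy trivial))
  deg := genFixing
  length := lengthHom
  deg_injective := genFixing_injective
  deg_mul x y := by
    rw [← mul_inv_eq_iff_eq_mul, conj_genFixing, perm_genFixing]
  length_deg x := rfl
  action_basis x y := by
    rw [Module.Basis.mk_apply, Module.Basis.mk_apply, basisVector, ind_action_mk, mk_eq, map_mul,
      map_mul, Equiv.Perm.mul_apply, perm_coset, perm_genFixing]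
    have : charConst 3 t (genFixing x) = t := rfl
    rw [this]
    simp
  coaction_basis x := by
    rw [Module.Basis.mk_apply, basisVector]
    have h := Ind.coaction_mk g12 (rho t) (coset x) ((charConst 3 t (coset x) : k)⁻¹)
    have h1 : coset x * g12 * (coset x)⁻¹ = genFixing x := by
      rw [← genFixing_two, conj_genFixing, perm_coset]
    rw [h1] at h
    exact h

/-- The degrees of the basis vectors are distinct, so the component of `g12` is a line, and a common
rescaling of the basis reaches any nonzero vector in it. -/
theorem exists_transpositionBasis {va : Ind g12 (rho t)} (hva : va ∈ (M t).component g12)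
    (h0 : va ≠ 0) : ∃ b : TranspositionBasis (M t) (t : k),
      b.deg = genFixing ∧ b.basis 2 = va := by
  set b := transpositionBasis t
  have hrepr : va = b.basis.repr va 2 • b.basis 2 := by
    conv_lhs => rw [← b.basis.sum_repr va]
    rw [Finset.sum_eq_single 2]
    · intro i _ hi
      by_contra h
      exact hi (genFixing_injective
        (b.deg_eq_of_mem_component hva fun e => h (by rw [e, zero_smul])))
    · simp
  have hr : b.basis.repr va 2 ≠ 0 := by
    intro h
    rw [h, zero_smul] at hrepr
    exact h0 hrepr
  refine ⟨b.smul (Units.mk0 _ hr), rfl, ?_⟩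
  conv_rhs => rw [hrepr]
  exact Module.Basis.unitsSMul_apply _

end

end TranspositionRack

end

theorem mainTheorem8 {k : Type*} [Field k] [IsAlgClosed k] [CharZero k] (t : kˣ) :
    (((t : k) = -1 ∨ (t : k) ^ 2 - t + 1 = 0) →
      ∀ C : Subalgebra k (TranspositionRack.M t).Nichols,
        (TranspositionRack.M t).IsLeftCoidealSubalgebra C →
          (TranspositionRack.M t).GeneratedInDegreeOne C) ∧
    (((t : k) ≠ -1 ∧ (t : k) ^ 2 - t + 1 ≠ 0) →
      ∀ va vb vc : YetterDrinfeld.Ind TranspositionRack.g12 (TranspositionRack.rho t),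
        va ∈ (TranspositionRack.M t).component TranspositionRack.g12 → va ≠ 0 →
        vb = (t : k)⁻¹ • (TranspositionRack.M t).action TranspositionRack.g23 va →
        vc = (t : k)⁻¹ • (TranspositionRack.M t).action TranspositionRack.g13 va →
        ∀ C : Subalgebra k (TranspositionRack.M t).Nichols,
          C = Algebra.adjoin k {(TranspositionRack.M t).ι vb,
            (TranspositionRack.M t).ι va * (TranspositionRack.M t).ι vb
              - (t : k) • ((TranspositionRack.M t).ι vc * (TranspositionRack.M t).ι va)
              + (t : k) ^ 2 • ((TranspositionRack.M t).ι vb * (TranspositionRack.M t).ι vc)} →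
          (TranspositionRack.M t).IsLeftCoidealSubalgebra C ∧
            ¬ (TranspositionRack.M t).GeneratedInDegreeOne C) := by
  refine ⟨fun ht C hC => ?_, fun ⟨ht1, ht2⟩ va vb vc hva h0 hvb hvc C hC => ?_⟩
  · refine (TranspositionRack.transpositionBasis t).generatedInDegreeOne ?_ hC
    rcases ht with ht | ht
    · rw [ht]; ring
    · linear_combination ((t : k) + 1) * ht
  · obtain ⟨b, hdeg, rfl⟩ := TranspositionRack.exists_transpositionBasis t hva h0
    have ht : 1 + (t : k) ^ 3 ≠ 0 := by
      have h : 1 + (t : k) ^ 3 = (t - (-1)) * (t ^ 2 - t + 1) := by ring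
      rw [h]
      exact mul_ne_zero (sub_ne_zero.2 ht1) ht2
    -- With `va = b.basis 2`, the vectors `vb` and `vc` have indices `0 ◃ 2 = 1` and `1 ◃ 2 = 0`;
    -- the factor `t⁻¹` cancels the cocycle.
    have hvb' : vb = b.basis 1 := by
      rw [hvb, ← TranspositionRack.genFixing_zero, ← hdeg, b.action_basis,
        inv_smul_smul₀ t.ne_zero]
      rfl
    have hvc' : vc = b.basis 0 := by
      rw [hvc, ← TranspositionRack.genFixing_one, ← hdeg, b.action_basis,
        inv_smul_smul₀ t.ne_zero]
      rfl
    subst hvb' hvc'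
    exact b.isLeftCoidealSubalgebra_and_not_generatedInDegreeOne (by decide) (by decide) ht hC
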